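/- Let $l>0$, $\rho^1<\rho^2$, and let $H^k_l=H^k(\mathbb R)\cap\{u:\|u\|_{L^\infty}<l\}$ for integers $k\ge 3$, functions being identified with their continuous representatives. For $u\in H^k_l$ put $$N[u](x)=\frac{\rho^2-\rho^1}{8l}\,\mathrm{P.V.}\!\int_{\mathbb R}\Big[\big(u'(x)-u'(x-\eta)\big)\Xi_1(x,\eta)+\big(u'(x)+u'(x-\eta)\big)\Xi_2(x,\eta)\Big]d\eta,$$ $$\Xi_1=\frac{\sinh(\frac{\pi}{2l}\eta)}{\cosh(\frac{\pi}{2l}\eta)-\cos\big(\frac{\pi}{2l}(u(x)-u(x-\eta))\big)},\qquad \Xi_2=\frac{\sinh(\frac{\pi}{2l}\eta)}{\cosh(\frac{\pi}{2l}\eta)+\cos\big(\frac{\pi}{2l}(u(x)+u(x-\eta))\big)},$$ where the principal value is taken both at $0$ and at infinity. There is a function $c=c(\|f_0\|_{L^1},\|f_0\|_{L^\infty},\rho^2,\rho^1,l)$, positive whenever $\|f_0\|_{L^1}>0$, $0<\|f_0\|_{L^\infty}<l$ and $\rho^1<\rho^2$, such that the following holds. Let $k\ge3$, $f_0\in L^1(\mathbb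 R)\cap H^k_l$, $f_0\ge0$, $f_0\not\equiv0$, let $T>0$, and let $f\in C([0,T],H^k_l)$ be a classical solution of $\partial_t f=N[f]$ on $\mathbb R\times(0,T)$ with $f(\cdot,0)=f_0$. Then $\|f(t)\|_{L^\infty}>0$ for all $t\in[0,T]$, the function $t\mapsto\|f(t)\|_{L^\infty}$ is Lipschitz on $[0,T]$, hence differentiable almost everywhere, and at every $t\in(0,T)$ at which it is differentiable $$\frac{d}{dt}\|f(t)\|_{L^\infty}\le -c\big(\|f_0\|_{L^1},\|f_0\|_{L^\infty},\rho^2,\rho^1,l\big)\,\exp\!\Big(-\frac{\pi\|f_0\|_{L^1}}{l\,\|f(t)\|_{L^\infty}}\Big).$$ Consequently, there is no nontrivial one-signed integrable steady state: if $k\ge 3$, $u\in L^1(\mathbb R)\cap H^k_l$, either $u\ge0$ everywhere or $u\le0$ everywhere, and $N[u](x)=0$ for every $x\in\mathbb R$, then $u=0$. -/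

import Mathlib

open MeasureTheory Set Filter Topology
open scoped ENNReal NNReal ContDiff

noncomputable section

/-- `v` is the weak (distributional) derivative of order `j` of `u` on the real line. -/
structure IsWeakDeriv (j : ℕ) (u v : ℝ → ℝ) : Prop where
  locInt : LocallyIntegrable u volume
  locInt_deriv : LocallyIntegrable v volume
  integral_eq : ∀ φ : ℝ → ℝ, ContDiff ℝ ∞ φ → HasCompactSupport φ →
    ∫ x, u x * iteratedDeriv j φ x = (-1) ^ j * ∫ x, v x * φ x

/-- The norm of the Sobolev space `H^k(ℝ)`: the square root of the sum of the squares of the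
`L²` norms of the weak derivatives of order at most `k`. Weak derivatives are unique almost
everywhere, so the infimum runs over one value; it is `∞` when some weak derivative does not
exist. -/
def sobolevENorm (k : ℕ) (u : ℝ → ℝ) : ℝ≥0∞ :=
  ⨅ (w : ℕ → ℝ → ℝ) (_ : ∀ j ≤ k, IsWeakDeriv j u (w j)),
    (∑ j ∈ Finset.range (k + 1), eLpNorm (w j) 2 volume ^ 2) ^ (1 / 2 : ℝ)

/-- Membership in `H^k_l(ℝ) = H^k(ℝ) ∩ {u : ‖u‖_{L^∞} < l}`, for `k ≥ 1`. As usual, an element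
of `H^k(ℝ)` is identified with its continuous representative. -/
structure MemHkl (k : ℕ) (l : ℝ) (u : ℝ → ℝ) : Prop where
  continuous : Continuous u
  sobolev : sobolevENorm k u < ⊤
  bounded : eLpNorm u ∞ volume < ENNReal.ofReal l

/-- The singular kernel `Ξ₁`. -/
def Xi1 (l : ℝ) (u : ℝ → ℝ) (x η : ℝ) : ℝ :=
  Real.sinh (Real.pi / (2 * l) * η) /
    (Real.cosh (Real.pi / (2 * l) * η) - Real.cos (Real.pi / (2 * l) * (u x - u (x - η))))

/-- The kernel `Ξ₂` produced by the boundaries of the strip. -/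
def Xi2 (l : ℝ) (u : ℝ → ℝ) (x η : ℝ) : ℝ :=
  Real.sinh (Real.pi / (2 * l) * η) /
    (Real.cosh (Real.pi / (2 * l) * η) + Real.cos (Real.pi / (2 * l) * (u x + u (x - η))))

/-- The integrand of the spatial operator of the internal wave equation. -/
def muskatIntegrand (l : ℝ) (u : ℝ → ℝ) (x η : ℝ) : ℝ :=
  (deriv u x - deriv u (x - η)) * Xi1 l u x η + (deriv u x + deriv u (x - η)) * Xi2 l u x η

/-- The principal value `P.V. ∫_ℝ h(η) dη`, with symmetric truncation at `0` and at infinity,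
exists and is equal to `a`. -/
structure HasPrincipalValue (h : ℝ → ℝ) (a : ℝ) : Prop where
  integrableOn : ∀ ε R : ℝ, 0 < ε → IntegrableOn h {η | ε < |η| ∧ |η| < R} volume
  tendsto : Tendsto (fun p : ℝ × ℝ => ∫ η in {η | p.1 < |η| ∧ |η| < p.2}, h η)
    (𝓝[>] 0 ×ˢ atTop) (𝓝 a)

/-- The right-hand side of the internal wave equation at the profile `u` and the point `x`
exists and is equal to `a`. -/
def HasMuskatRHS (ρ1 ρ2 l : ℝ) (u : ℝ → ℝ) (x a : ℝ) : Prop :=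
  ∃ p : ℝ, HasPrincipalValue (muskatIntegrand l u x) p ∧ a = (ρ2 - ρ1) / (8 * l) * p

/-- `f` (as a function of time `t`, then of space `x`) is a classical solution in
`C([0,T], H^k_l(ℝ))` of the internal wave equation with initial datum `f₀`. -/
structure IsClassicalSolution (ρ1 ρ2 l : ℝ) (k : ℕ) (T : ℝ) (f₀ : ℝ → ℝ) (f : ℝ → ℝ → ℝ) :
    Prop where
  mem : ∀ t ∈ Icc 0 T, MemHkl k l (f t)
  continuous_time : ∀ t ∈ Icc 0 T,
    Tendsto (fun s => sobolevENorm k (fun x => f s x - f t x)) (𝓝[Icc 0 T] t) (𝓝 0)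
  initial : f 0 = f₀
  equation : ∀ t ∈ Ioo 0 T, ∀ x : ℝ, ∃ a : ℝ,
    HasMuskatRHS ρ1 ρ2 l (f t) x a ∧ HasDerivAt (fun s => f s x) a t

/-- `u` is a steady state of the internal wave equation. -/
def IsSteadyState (ρ1 ρ2 l : ℝ) (u : ℝ → ℝ) : Prop :=
  ∀ x : ℝ, HasMuskatRHS ρ1 ρ2 l u x 0

end

/-! Write μ = π/(2l), y = μη, U = μu(x), V = μu(x-η). The product of the denominators of Ξ₁ and Ξ₂
is the sum of two squares (sin U cosh y - sin V)² + (sinh y cos U)² (`denominator_factorization`).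
Hence the integrand is 2/μ times the x-derivative of the angle `phase`, the arctangent of the
quotient of the two squared quantities. Two facts follow.

At a critical point x of u, the η-derivative of the phase is minus its x-derivative plus an explicit
kernel without derivatives of u (`hasDerivAt_phase_lag`). Subtracting the phase of the constant
profile u(x) makes all boundary terms vanish, so the principal value is -∫ `gapKernel`, and this
kernel has the sign of u(x) - u(x-η). At a maximum point the principal value is therefore
nonpositive, which gives the maximum principle. If moreover u ≥ 0 has mass at most A, Chebyshev
bounds the measure of {η : u(x-η) ≥ u(x)/2} by R = 2A/u(x). At least R of the length of [-R, R] then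
remains, and there the kernel is at least a multiple of u(x) exp(-μR). Since μR = πA/(l u(x)), this
is the exponential of the theorem (`HasPrincipalValue.le_of_forall_le`).

The equation is also a conservation law: its right-hand side is a constant times the x-derivative of
`flux`, in the weak sense. The flux tends to 0 at infinity uniformly in time, so testing with wide
cutoffs shows that the mass of f(t) is at most that of f₀, and that f(t) = 0 would force f₀ = 0.

Where t ↦ ‖f(t)‖_∞ is differentiable, its derivative is ∂ₜf at a maximum point, so the two facts
combine. For a nonnegative steady state the same inequality, with its own mass as A, makes the
principal value negative at the maximum, a contradiction; nonpositive states reduce to this case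
because the operator is odd. The space H^k enters only through `RegularProfile`, a consequence of
one-dimensional Sobolev embedding. -/

/-! ### Weak derivatives and Sobolev embedding on the line -/

theorem MeasureTheory.LocallyIntegrable.intervalIntegrable {w : ℝ → ℝ}
    (hw : LocallyIntegrable w volume) (a b : ℝ) : IntervalIntegrable w volume a b :=
  intervalIntegrable_iff.2 ((hw.integrableOn_isCompact isCompact_uIcc).mono_set uIoc_subset_uIcc)

theorem HasCompactSupport.exists_support_subset_Ioo {φ : ℝ → ℝ} (hφ : HasCompactSupport φ) :
    ∃ R > 0, ∀ x, R ≤ |x| → φ x = 0 := by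
  obtain ⟨R, hR⟩ := hφ.isCompact.isBounded.subset_closedBall 0
  refine ⟨max R 0 + 1, by positivity, fun x hx => ?_⟩
  by_contra h
  have h1 := hR (subset_tsupport _ (Function.mem_support.2 h))
  rw [mem_closedBall_zero_iff, Real.norm_eq_abs] at h1
  have := le_max_left R 0
  linarith

theorem integral_eq_intervalIntegral_of_eq_zero {g : ℝ → ℝ} {R : ℝ}
    (h : ∀ x, R ≤ |x| → g x = 0) : ∫ x, g x = ∫ x in (-R)..R, g x := by
  symm
  apply intervalIntegral.integral_eq_integral_of_support_subset
  intro x hx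
  have : |x| < R := by
    by_contra h'
    exact hx (h x (not_lt.1 h'))
  rw [abs_lt] at this
  exact ⟨this.1, this.2.le⟩

/-- A primitive of a locally integrable function is absolutely continuous on compact intervals,
which suffices for integration by parts; the boundary terms vanish with φ. -/
theorem integral_primitive_mul_deriv {w φ : ℝ → ℝ} (hw : LocallyIntegrable w volume)
    (hφ : ContDiff ℝ ∞ φ) (hc : HasCompactSupport φ) :
    ∫ x, (∫ y in (0)..x, w y) * deriv φ x = -∫ x, w x * φ x := by
  obtain ⟨R, hR, h0⟩ := hc.exists_support_subset_Ioo
  obtain ⟨R', hR', h0'⟩ := hc.deriv.exists_support_subset_Ioo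
  set S := max R R'
  have hS : 0 < S := lt_max_of_lt_left hR
  have hSS : -S ≤ S := by linarith
  have hint : ∀ a b, IntervalIntegrable w volume a b := fun a b => hw.intervalIntegrable a b
  rw [integral_eq_intervalIntegral_of_eq_zero (R := S)
      (fun x hx => by rw [h0' x ((le_max_right _ _).trans hx), mul_zero]),
    integral_eq_intervalIntegral_of_eq_zero (R := S)
      (fun x hx => by rw [h0 x ((le_max_left _ _).trans hx), mul_zero])]
  have hac : AbsolutelyContinuousOnInterval (fun x => ∫ y in (0)..x, w y) (-S) S :=
    (hint (-S) S).absolutelyContinuousOnInterval_intervalIntegral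
      (by rw [uIcc_of_le hSS]; constructor <;> linarith)
  have hac' : AbsolutelyContinuousOnInterval φ (-S) S :=
    ContDiffOn.absolutelyContinuousOnInterval (hφ.contDiffOn.of_le (by simp))
  rw [hac.integral_mul_deriv_eq_deriv_mul hac', h0 S (by
      rw [abs_of_pos hS]; exact le_max_left _ _), h0 (-S) (by
      rw [abs_neg, abs_of_pos hS]; exact le_max_left _ _)]
  simp only [mul_zero, sub_self, zero_sub, neg_inj]
  apply intervalIntegral.integral_congr_ae
  filter_upwards [_root_.LocallyIntegrable.ae_hasDerivAt_integral hw] with x hx _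
  rw [(hx 0).deriv]

/-- The primitive started to the left of the support vanishes again to its right because the total
integral is zero. -/
theorem exists_smooth_primitive {χ : ℝ → ℝ} (hχ : ContDiff ℝ ∞ χ) (hc : HasCompactSupport χ)
    (h0 : ∫ x, χ x = 0) : ∃ φ, ContDiff ℝ ∞ φ ∧ HasCompactSupport φ ∧ deriv φ = χ := by
  obtain ⟨R, hR, hz⟩ := hc.exists_support_subset_Ioo
  have hd : ∀ x, HasDerivAt (fun x => ∫ y in (-R)..x, χ y) (χ x) x := fun x =>
    intervalIntegral.integral_hasDerivAt_right (hχ.continuous.intervalIntegrable _ _)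
      hχ.continuous.stronglyMeasurable.stronglyMeasurableAtFilter hχ.continuous.continuousAt
  have hderiv : deriv (fun x => ∫ y in (-R)..x, χ y) = χ := funext fun x => (hd x).deriv
  refine ⟨fun x => ∫ y in (-R)..x, χ y, ?_, ?_, hderiv⟩
  · rw [contDiff_infty_iff_deriv]
    exact ⟨fun x => (hd x).differentiableAt, by rwa [hderiv]⟩
  · refine HasCompactSupport.intro (isCompact_Icc (a := -R) (b := R)) fun x hx => ?_
    rw [mem_Icc, not_and_or, not_le, not_le] at hx
    rcases hx with hx | hx
    · rw [intervalIntegral.integral_congr (g := fun _ => 0)]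
      · simp
      · intro y hy
        rw [uIcc_of_ge hx.le] at hy
        apply hz
        rw [abs_of_neg (by linarith [hy.2])]
        linarith [hy.2]
    · rw [← intervalIntegral.integral_add_adjacent_intervals
        (hχ.continuous.intervalIntegrable (-R) R) (hχ.continuous.intervalIntegrable R x),
        ← integral_eq_intervalIntegral_of_eq_zero hz, h0, zero_add,
        intervalIntegral.integral_congr (g := fun _ => 0)]
      · simp
      · intro y hy
        rw [uIcc_of_le hx.le] at hy
        apply hz
        rw [abs_of_nonneg (by linarith [hy.1])]
        linarith [hy.1]

/-- The du Bois-Reymond lemma. -/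
theorem ae_eq_const_of_integral_mul_deriv_eq_zero {v : ℝ → ℝ} (hv : LocallyIntegrable v volume)
    (h : ∀ φ : ℝ → ℝ, ContDiff ℝ ∞ φ → HasCompactSupport φ → ∫ x, v x * deriv φ x = 0) :
    ∃ c, v =ᵐ[volume] fun _ => c := by
  let b : ContDiffBump (0 : ℝ) := ⟨1, 2, one_pos, one_lt_two⟩
  set ρ := b.normed volume
  have hρ : ContDiff ℝ ∞ ρ := b.contDiff_normed
  have hρc : HasCompactSupport ρ := b.hasCompactSupport_normed
  have hmul : ∀ ψ : ℝ → ℝ, Continuous ψ → HasCompactSupport ψ →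
      Integrable (fun x => ψ x * v x) := fun ψ h1 h2 => by
    simpa using hv.integrable_smul_left_of_hasCompactSupport h1 h2
  refine ⟨∫ x, ρ x * v x, ?_⟩
  refine ae_eq_of_integral_contDiff_smul_eq hv (locallyIntegrable_const _) fun ψ hψ hψc => ?_
  set I := ∫ x, ψ x
  have hIc : HasCompactSupport fun x => ψ x - I * ρ x :=
    hψc.sub (hρc.mul_left (f := fun _ => I))
  -- Since ρ has integral one, ψ - Iρ has integral zero and is the derivative of a test function.
  obtain ⟨φ, hφ, hφc, hφd⟩ := exists_smooth_primitive (χ := fun x => ψ x - I * ρ x)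
    (hψ.sub (contDiff_const.mul hρ)) hIc (by
      rw [integral_sub (hψ.continuous.integrable_of_hasCompactSupport hψc)
        ((hρ.continuous.integrable_of_hasCompactSupport hρc).const_mul _), integral_const_mul,
        b.integral_normed, mul_one, sub_self])
  have := h φ hφ hφc
  rw [hφd] at this
  have h2 : ∀ x, v x * (ψ x - I * ρ x) = ψ x * v x - I * (ρ x * v x) := fun x => by ring
  simp_rw [h2] at this
  rw [integral_sub (hmul ψ hψ.continuous hψc) ((hmul ρ hρ.continuous hρc).const_mul _),
    integral_const_mul] at this
  simp only [smul_eq_mul]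
  rw [integral_mul_const]
  linarith

theorem IsWeakDeriv.exists_ae_eq_primitive {v w : ℝ → ℝ} (h : IsWeakDeriv 1 v w) :
    ∃ c, v =ᵐ[volume] fun x => c + ∫ y in (0)..x, w y := by
  have hcont : Continuous fun x => ∫ y in (0)..x, w y :=
    intervalIntegral.continuous_primitive (fun a b => h.locInt_deriv.intervalIntegrable a b) 0
  obtain ⟨c, hc⟩ := ae_eq_const_of_integral_mul_deriv_eq_zero
    (v := fun x => v x - ∫ y in (0)..x, w y) (h.locInt.sub hcont.locallyIntegrable) (by
      intro φ hφ hφc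
      have h1 := h.integral_eq φ hφ hφc
      rw [iteratedDeriv_one, pow_one] at h1
      have hd : Continuous (deriv φ) := hφ.continuous_deriv (by simp)
      simp_rw [sub_mul]
      rw [integral_sub, h1, integral_primitive_mul_deriv h.locInt_deriv hφ hφc]
      · ring
      · simpa [mul_comm] using
          h.locInt.integrable_smul_left_of_hasCompactSupport hd hφc.deriv
      · exact (hcont.mul hd).integrable_of_hasCompactSupport hφc.deriv.mul_left)
  refine ⟨c, ?_⟩
  filter_upwards [hc] with x hx
  linarith

/-- The derivative φ' is itself a test function, so the order-`j` identity for φ' can be compared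
with the order-`j + 1` identity for φ. -/
theorem IsWeakDeriv.of_succ {j : ℕ} {u v w : ℝ → ℝ} (hv : IsWeakDeriv j u v)
    (hw : IsWeakDeriv (j + 1) u w) : IsWeakDeriv 1 v w where
  locInt := hv.locInt_deriv
  locInt_deriv := hw.locInt_deriv
  integral_eq φ hφ hφc := by
    have h1 := hv.integral_eq (deriv φ) (contDiff_infty_iff_deriv.1 hφ).2 hφc.deriv
    have h2 := hw.integral_eq φ hφ hφc
    rw [iteratedDeriv_succ', h1] at h2
    have h3 : ((-1 : ℝ) ^ j) ≠ 0 := by simp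
    rw [iteratedDeriv_one]
    apply mul_left_cancel₀ h3
    rw [h2]; ring

theorem IsWeakDeriv.ae_eq_of_zero {u w : ℝ → ℝ} (h : IsWeakDeriv 0 u w) : w =ᵐ[volume] u := by
  refine ae_eq_of_integral_contDiff_smul_eq h.locInt_deriv h.locInt fun φ hφ hφc => ?_
  have := h.integral_eq φ hφ hφc
  simpa [mul_comm] using this.symm

theorem integral_sq_le_of_eLpNorm_le {w : ℝ → ℝ} {E : ℝ} (hE : 0 ≤ E)
    (hm : AEStronglyMeasurable w volume) (h : eLpNorm w 2 volume ≤ ENNReal.ofReal E) :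
    Integrable (fun x => w x ^ 2) ∧ ∫ x, w x ^ 2 ≤ E ^ 2 := by
  have hL : MemLp w 2 volume := ⟨hm, h.trans_lt ENNReal.ofReal_lt_top⟩
  refine ⟨hL.integrable_sq, ?_⟩
  have h1 : lpNorm w 2 volume ≤ E := by
    rw [← toReal_eLpNorm hm]
    exact ENNReal.toReal_le_of_le_ofReal hE h
  have h2 := lpNorm_eq_integral_norm_rpow_toReal (p := 2) (by simp) (by simp) hm
  simp only [ENNReal.toReal_ofNat, Real.norm_eq_abs, Real.rpow_ofNat, sq_abs] at h2
  have h3 : 0 ≤ ∫ x, w x ^ 2 := integral_nonneg fun x => sq_nonneg _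
  have h4 : (∫ x, w x ^ 2) = lpNorm w 2 volume ^ 2 := by
    rw [h2, ← Real.rpow_natCast, ← Real.rpow_mul h3]; norm_num
  rw [h4]
  exact pow_le_pow_left₀ lpNorm_nonneg h1 2

/-- The inequality |w| ≤ w²/(2E) + E/2, integrated over a unit interval, replaces Cauchy–Schwarz. -/
theorem integral_abs_unit_interval_le {w : ℝ → ℝ} {E : ℝ} (hE : 0 < E)
    (hw : LocallyIntegrable w volume) (hi : Integrable fun x => w x ^ 2)
    (h : ∫ x, w x ^ 2 ≤ E ^ 2) (x : ℝ) : ∫ y in x..(x + 1), |w y| ≤ E := by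
  have hx : x ≤ x + 1 := by linarith
  calc ∫ y in x..(x + 1), |w y| ≤ ∫ y in x..(x + 1), (w y ^ 2 / (2 * E) + E / 2) := by
        apply intervalIntegral.integral_mono_on hx
        · exact (hw.intervalIntegrable x (x + 1)).abs
        · exact ((hi.intervalIntegrable).div_const _).add (by simp)
        · intro y _
          rw [← sq_abs, div_add_div _ _ (by positivity) (by positivity), le_div_iff₀ (by positivity)]
          nlinarith [sq_nonneg (|w y| - E)]
    _ = (∫ y in x..(x + 1), w y ^ 2) / (2 * E) + E / 2 := by
        rw [intervalIntegral.integral_add ((hi.intervalIntegrable).div_const _) (by simp),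
          intervalIntegral.integral_div]
        simp
    _ ≤ E ^ 2 / (2 * E) + E / 2 := by
        gcongr
        refine le_trans ?_ h
        rw [intervalIntegral.integral_of_le hx]
        exact setIntegral_le_integral hi (ae_of_all _ fun x => sq_nonneg _)
    _ = E := by field_simp; ring

/-- On [x, x+1] the primitive varies by at most ∫|w| ≤ E from its value at x, and its mean absolute
value is at most E; hence the bound 2E. -/
theorem IsWeakDeriv.exists_bounded_representative {v w : ℝ → ℝ} (h : IsWeakDeriv 1 v w) {E : ℝ}
    (hE : 0 < E) (hv : eLpNorm v 2 volume ≤ ENNReal.ofReal E)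
    (hw : eLpNorm w 2 volume ≤ ENNReal.ofReal E) :
    ∃ c, (v =ᵐ[volume] fun x => c + ∫ y in (0)..x, w y) ∧
      (Continuous fun x => c + ∫ y in (0)..x, w y) ∧
      ∀ x, |c + ∫ y in (0)..x, w y| ≤ 2 * E := by
  obtain ⟨c, hc⟩ := h.exists_ae_eq_primitive
  have hint : ∀ a b, IntervalIntegrable w volume a b := fun a b =>
    h.locInt_deriv.intervalIntegrable a b
  have hcont : Continuous fun x => c + ∫ y in (0)..x, w y :=
    continuous_const.add (intervalIntegral.continuous_primitive hint 0)
  refine ⟨c, hc, hcont, fun x => ?_⟩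
  have hV2 := integral_sq_le_of_eLpNorm_le hE.le hcont.aestronglyMeasurable
    ((eLpNorm_congr_ae hc).symm.le.trans hv)
  have hw2 := integral_sq_le_of_eLpNorm_le hE.le h.locInt_deriv.aestronglyMeasurable hw
  have hV := integral_abs_unit_interval_le hE hcont.locallyIntegrable hV2.1 hV2.2 x
  have hW := integral_abs_unit_interval_le hE h.locInt_deriv hw2.1 hw2.2 x
  have hx : x ≤ x + 1 := by linarith
  have key : ∀ y ∈ Icc x (x + 1), |c + ∫ y in (0)..x, w y| - E ≤ |c + ∫ z in (0)..y, w z| := by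
    intro y hy
    have h1 : (∫ z in (0)..y, w z) = (∫ z in (0)..x, w z) + ∫ z in x..y, w z :=
      (intervalIntegral.integral_add_adjacent_intervals (hint _ _) (hint _ _)).symm
    have h2 : |∫ z in x..y, w z| ≤ E :=
      calc |∫ z in x..y, w z| ≤ ∫ z in x..y, |w z| :=
            intervalIntegral.abs_integral_le_integral_abs hy.1
        _ ≤ ∫ z in x..(x + 1), |w z| :=
            intervalIntegral.integral_mono_interval le_rfl hy.1 hy.2
              (ae_of_all _ fun _ => abs_nonneg _) (hint _ _).abs
        _ ≤ E := hW
    have h3 : c + ∫ y in (0)..x, w y = (c + ∫ z in (0)..y, w z) - ∫ z in x..y, w z := by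
      rw [h1]; ring
    rw [h3]
    have := abs_sub (c + ∫ z in (0)..y, w z) (∫ z in x..y, w z)
    linarith
  have h4 : ∫ _ in x..(x + 1), (|c + ∫ y in (0)..x, w y| - E) ≤
      ∫ y in x..(x + 1), |c + ∫ z in (0)..y, w z| :=
    intervalIntegral.integral_mono_on hx (by simp) (hcont.abs.intervalIntegrable _ _) key
  simp only [intervalIntegral.integral_const, add_sub_cancel_left, smul_eq_mul, one_mul] at h4
  linarith

/-- The function u² is integrable with integrable derivative 2uu', so it tends to 0 at both ends. -/
theorem tendsto_zero_of_sq_integrable {u u' : ℝ → ℝ} (hd : ∀ x, HasDerivAt u (u' x) x)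
    (hu : MemLp u 2 volume) (hu' : MemLp u' 2 volume) : Tendsto u (cocompact ℝ) (𝓝 0) := by
  have h1 : ∀ x, HasDerivAt (fun x => u x ^ 2) (2 * (u x * u' x)) x := fun x => by
    have := (hd x).pow 2
    simpa [mul_assoc, Pi.pow_def] using this
  have h2 : Integrable (fun x => 2 * (u x * u' x)) := (hu.integrable_mul hu').const_mul 2
  have h3 : Tendsto (fun x => u x ^ 2) (cocompact ℝ) (𝓝 0) := by
    rw [cocompact_eq_atBot_atTop]
    exact (tendsto_zero_of_hasDerivAt_of_integrableOn_Iic (a := 0) (fun x _ => h1 x)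
      h2.integrableOn hu.integrable_sq.integrableOn).sup
      (tendsto_zero_of_hasDerivAt_of_integrableOn_Ioi (a := 0) (fun x _ => h1 x)
      h2.integrableOn hu.integrable_sq.integrableOn)
  have h4 := h3.sqrt
  simp only [Real.sqrt_sq_eq_abs, Real.sqrt_zero] at h4
  exact (tendsto_zero_iff_abs_tendsto_zero _).2 h4

/-- Each weak derivative of order at most 2 has a continuous representative bounded through the next
one. The bound on the second derivative is the Lipschitz constant of the first, which is why three
weak derivatives are needed. -/
theorem sobolev_bounds {k : ℕ} (hk : 3 ≤ k) {u : ℝ → ℝ} (hu : Continuous u) {E : ℝ}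
    (h : sobolevENorm k u < ENNReal.ofReal E) :
    Differentiable ℝ u ∧ (∀ x, |u x| ≤ 2 * E) ∧ (∀ x, |deriv u x| ≤ 2 * E) ∧
      (∀ x y, |deriv u x - deriv u y| ≤ 2 * E * |x - y|) ∧ Tendsto u (cocompact ℝ) (𝓝 0) := by
  have hE : 0 < E := ENNReal.ofReal_pos.1 (bot_lt_of_lt h)
  simp only [sobolevENorm, iInf_lt_iff] at h
  obtain ⟨w, hw, hlt⟩ := h
  have hb : ∀ j ≤ k, eLpNorm (w j) 2 volume ≤ ENNReal.ofReal E := by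
    intro j hj
    refine le_trans ?_ hlt.le
    calc eLpNorm (w j) 2 volume = (eLpNorm (w j) 2 volume ^ 2) ^ (1 / 2 : ℝ) := by
          rw [← ENNReal.rpow_natCast, ← ENNReal.rpow_mul]; norm_num
      _ ≤ _ := by
          apply ENNReal.rpow_le_rpow _ (by norm_num)
          exact Finset.single_le_sum (f := fun j => eLpNorm (w j) 2 volume ^ 2)
            (fun _ _ => zero_le) (Finset.mem_range.2 (by omega))
  have h0 := (hw 0 (by omega)).ae_eq_of_zero
  have d1 := (hw 0 (by omega)).of_succ (hw 1 (by omega))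
  have d2 := (hw 1 (by omega)).of_succ (hw 2 (by omega))
  have d3 := (hw 2 (by omega)).of_succ (hw 3 (by omega))
  obtain ⟨c0, e0, k0, b0⟩ := d1.exists_bounded_representative hE (hb 0 (by omega)) (hb 1 (by omega))
  obtain ⟨c1, e1, k1, b1⟩ := d2.exists_bounded_representative hE (hb 1 (by omega)) (hb 2 (by omega))
  obtain ⟨c2, e2, k2, b2⟩ := d3.exists_bounded_representative hE (hb 2 (by omega)) (hb 3 (by omega))
  have hu_eq : u = fun x => c0 + ∫ y in (0)..x, w 1 y :=
    (hu.ae_eq_iff_eq (μ := volume) k0).1 (h0.symm.trans e0)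
  -- Replacing the integrand by its continuous representative makes the primitive classically
  -- differentiable everywhere.
  have prim : ∀ (c : ℝ) (p q : ℝ → ℝ), p =ᵐ[volume] q → Continuous q → ∀ x,
      HasDerivAt (fun x => c + ∫ y in (0)..x, p y) (q x) x := by
    intro c p q hpq hq x
    have : (fun x => c + ∫ y in (0)..x, p y) = fun x => c + ∫ y in (0)..x, q y := by
      funext x
      rw [intervalIntegral.integral_congr_ae (hpq.mono fun y hy _ => hy)]
    rw [this]
    exact (intervalIntegral.integral_hasDerivAt_right (hq.intervalIntegrable _ _)
      hq.stronglyMeasurable.stronglyMeasurableAtFilter hq.continuousAt).const_add c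
  have hd0 := prim c0 _ _ e1 k1
  have hd1 := prim c1 _ _ e2 k2
  rw [← hu_eq] at hd0
  have hderiv : deriv u = fun x => c1 + ∫ y in (0)..x, w 2 y := funext fun x => (hd0 x).deriv
  refine ⟨fun x => (hd0 x).differentiableAt, fun x => ?_, fun x => ?_, fun x y => ?_, ?_⟩
  · have := b0 x
    rwa [hu_eq]
  · rw [hderiv]; exact b1 x
  · rw [hderiv]
    have := Convex.norm_image_sub_le_of_norm_hasDerivWithin_le (s := univ) (C := 2 * E)
      (fun z _ => (hd1 z).hasDerivWithinAt) (fun z _ => b2 z) convex_univ (mem_univ y) (mem_univ x)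
    simpa only [Real.norm_eq_abs] using this
  · refine tendsto_zero_of_sq_integrable hd0 ?_ ?_
    · exact ⟨hu.aestronglyMeasurable, by
        rw [eLpNorm_congr_ae h0.symm]; exact (hb 0 (by omega)).trans_lt ENNReal.ofReal_lt_top⟩
    · exact ⟨k1.aestronglyMeasurable, by
        rw [eLpNorm_congr_ae e1.symm]; exact (hb 1 (by omega)).trans_lt ENNReal.ofReal_lt_top⟩

/-! ### Elementary bounds for the hyperbolic kernels -/

theorem integrable_exp_neg_mul_abs {κ : ℝ} (hκ : 0 < κ) :
    Integrable fun η : ℝ => Real.exp (-|κ * η|) := by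
  rw [← integrableOn_univ, ← Iic_union_Ioi (a := (0 : ℝ))]
  apply IntegrableOn.union
  · refine (integrableOn_exp_mul_Iic hκ 0).congr_fun (fun η hη => ?_) measurableSet_Iic
    simp only
    rw [abs_of_nonpos (mul_nonpos_of_nonneg_of_nonpos hκ.le hη), neg_neg]
  · refine (integrableOn_exp_mul_Ioi (neg_neg_of_pos hκ) 0).congr_fun (fun η hη => ?_)
      measurableSet_Ioi
    simp only
    rw [abs_of_nonneg (mul_nonneg hκ.le (le_of_lt hη)), neg_mul]

theorem cosh_ge_exp_abs (y : ℝ) : Real.exp |y| / 2 ≤ Real.cosh y := by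
  rw [← Real.cosh_abs, Real.cosh_eq]
  linarith [Real.exp_pos (-|y|)]

theorem inv_cosh_le (y : ℝ) : 1 / Real.cosh y ≤ 2 * Real.exp (-|y|) := by
  rw [div_le_iff₀ (Real.cosh_pos y), Real.exp_neg]
  have h := cosh_ge_exp_abs y
  have h2 := Real.exp_pos |y|
  field_simp
  linarith

theorem half_sq_le_cosh_sub_one (y : ℝ) : y ^ 2 / 2 ≤ Real.cosh y - 1 := by
  have h : Real.cosh y - 1 = 2 * Real.sinh (y / 2) ^ 2 := by
    have := Real.cosh_two_mul (y / 2)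
    have h2 := Real.cosh_sq (y / 2)
    rw [show 2 * (y / 2) = y by ring] at this
    linarith
  have h3 : (y / 2) ^ 2 ≤ Real.sinh (y / 2) ^ 2 := by
    apply sq_le_sq.2
    rcases le_total 0 (y / 2) with h | h
    · have := Real.self_le_sinh_iff.2 h
      rwa [abs_of_nonneg h, abs_of_nonneg (h.trans this)]
    · have := Real.sinh_le_self_iff.2 h
      rw [abs_of_nonpos h, abs_of_nonpos (this.trans h)]
      linarith
  rw [h]
  linarith

theorem exp_abs_le_cosh_sub_one {y : ℝ} (hy : 1 ≤ |y|) : Real.exp |y| / 8 ≤ Real.cosh y - 1 := by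
  rw [← Real.cosh_abs, Real.cosh_eq]
  have h1 := Real.exp_pos (-|y|)
  have h2 : Real.exp 1 ≤ Real.exp |y| := Real.exp_le_exp.2 hy
  have h3 := Real.exp_one_gt_d9
  linarith

theorem abs_sinh_le_cosh (y : ℝ) : |Real.sinh y| ≤ Real.cosh y := by
  have := Real.cosh_sq y
  exact abs_le_of_sq_le_sq (by linarith) (Real.cosh_pos y).le

theorem abs_sinh_le_mul_cosh (y : ℝ) : |Real.sinh y| ≤ |y| * Real.cosh y := by
  have key : ∀ z : ℝ, 0 ≤ z → Real.sinh z ≤ z * Real.cosh z := by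
    intro z hz
    have hmono : MonotoneOn (fun z => z * Real.cosh z - Real.sinh z) (Ici 0) := by
      apply monotoneOn_of_deriv_nonneg (convex_Ici 0)
      · fun_prop
      · fun_prop
      · intro x hx
        rw [interior_Ici] at hx
        have : HasDerivAt (fun z => z * Real.cosh z - Real.sinh z)
            (1 * Real.cosh x + x * Real.sinh x - Real.cosh x) x :=
          ((hasDerivAt_id x).mul (Real.hasDerivAt_cosh x)).sub (Real.hasDerivAt_sinh x)
        rw [this.deriv]
        have h1 := Real.sinh_pos_iff.2 hx
        have h2 : 0 < x := hx
        nlinarith [mul_pos h2 h1]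
    have := hmono (mem_Ici.2 le_rfl) (mem_Ici.2 hz) hz
    simp at this
    linarith
  have h := key |y| (abs_nonneg y)
  rwa [Real.cosh_abs, ← Real.abs_sinh] at h

theorem cosh_le_two_of_abs_le_one {y : ℝ} (hy : |y| ≤ 1) : Real.cosh y ≤ 2 := by
  have h : Real.cosh y ≤ Real.cosh 1 := Real.cosh_le_cosh.2 (by simpa using hy)
  rw [Real.cosh_eq 1] at h
  have h3 := Real.exp_one_lt_d9
  have h4 : Real.exp (-1) ≤ 1 := Real.exp_le_one_iff.2 (by norm_num)
  linarith

/-- A function bounded for `|y| ≤ 1` and exponentially small for `1 ≤ |y|` has an exponential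
envelope. -/
theorem le_envelope {z y K : ℝ} (hnear : |y| ≤ 1 → z ≤ K)
    (hfar : 1 ≤ |y| → z ≤ K * Real.exp (-|y|)) (hK : 0 ≤ K) : z ≤ 3 * K * Real.exp (-|y|) := by
  rcases le_total |y| 1 with h | h
  · have h1 : Real.exp (-1) ≤ Real.exp (-|y|) := Real.exp_le_exp.2 (by linarith)
    have h2 : 1 / 3 ≤ Real.exp (-1) := by
      rw [Real.exp_neg, one_div]
      exact inv_anti₀ (Real.exp_pos 1) (by linarith [Real.exp_one_lt_d9])
    have := hnear h
    nlinarith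
  · have := hfar h
    have h2 := Real.exp_pos (-|y|)
    nlinarith [mul_nonneg hK h2.le]

/-- Whatever δ is, the denominator is at least cosh y - 1 ≥ y²/2, while the numerator is at most
2|y|: the singularity is no worse than 4/|y|. -/
theorem abs_mul_singular_kernel_le {y : ℝ} (δ : ℝ) (hy : |y| ≤ 1) :
    |y| * |Real.sinh y / (Real.cosh y - Real.cos δ)| ≤ 4 := by
  rcases eq_or_ne y 0 with rfl | h0
  · simp
  have h1 : y ^ 2 / 2 ≤ Real.cosh y - Real.cos δ :=
    (half_sq_le_cosh_sub_one y).trans (by linarith [Real.cos_le_one δ])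
  have hy2 : 0 < y ^ 2 := by positivity
  have h2 : 0 < Real.cosh y - Real.cos δ := by linarith
  rw [abs_div, abs_of_pos h2, mul_div_assoc', div_le_iff₀ h2]
  have h3 := abs_sinh_le_mul_cosh y
  have h4 := cosh_le_two_of_abs_le_one hy
  calc |y| * |Real.sinh y| ≤ |y| * (|y| * 2) := by gcongr; exact h3.trans (by gcongr)
    _ = 2 * y ^ 2 := by rw [← sq_abs y]; ring
    _ ≤ _ := by linarith

/-- The difference is sinh y cos δ over a product of two denominators, each of order exp |y|. -/
theorem abs_singular_kernel_sub_tanh_le {y : ℝ} (δ : ℝ) (hy : 1 ≤ |y|) :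
    |Real.sinh y / (Real.cosh y - Real.cos δ) - Real.sinh y / Real.cosh y| ≤
      8 * Real.exp (-|y|) := by
  have h1 := exp_abs_le_cosh_sub_one hy
  have h0 := Real.exp_pos |y|
  have h2 : Real.cosh y - 1 ≤ Real.cosh y - Real.cos δ := by linarith [Real.cos_le_one δ]
  have h3 : 0 < Real.cosh y - Real.cos δ := by linarith
  have hc := Real.cosh_pos y
  have e : Real.sinh y / (Real.cosh y - Real.cos δ) - Real.sinh y / Real.cosh y =
      Real.sinh y * Real.cos δ / (Real.cosh y * (Real.cosh y - Real.cos δ)) := by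
    field_simp
    ring
  rw [e, abs_div, abs_of_pos (mul_pos hc h3), div_le_iff₀ (mul_pos hc h3), abs_mul]
  calc |Real.sinh y| * |Real.cos δ| ≤ Real.cosh y * 1 := by
        gcongr
        · exact abs_sinh_le_cosh y
        · exact Real.abs_cos_le_one δ
    _ = 8 * Real.exp (-|y|) * (Real.cosh y * (Real.exp |y| / 8)) := by
        rw [Real.exp_neg]; field_simp
    _ ≤ _ := by gcongr; linarith

theorem regular_denominator_ge {y σ θ : ℝ} (hσ : θ ≤ Real.cos σ) (hθ : -1 < θ) :
    (1 + θ) / 2 * Real.cosh y ≤ Real.cosh y + Real.cos σ := by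
  have h1 := Real.one_le_cosh y
  have h2 := hσ.trans (Real.cos_le_one σ)
  nlinarith [mul_nonneg (sub_nonneg.2 h1) (sub_nonneg.2 h2)]

theorem abs_regular_kernel_sub_tanh_le {y σ θ : ℝ} (hσ : θ ≤ Real.cos σ) (hθ : -1 < θ) :
    |Real.sinh y / (Real.cosh y + Real.cos σ) - Real.sinh y / Real.cosh y| ≤
      4 / (1 + θ) * Real.exp (-|y|) := by
  have hd := regular_denominator_ge (y := y) hσ hθ
  have hc := Real.cosh_pos y
  have hθ' : 0 < 1 + θ := by linarith
  have h3 : 0 < Real.cosh y + Real.cos σ := lt_of_lt_of_le (by positivity) hd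
  have e : Real.sinh y / (Real.cosh y + Real.cos σ) - Real.sinh y / Real.cosh y =
      -(Real.sinh y * Real.cos σ) / (Real.cosh y * (Real.cosh y + Real.cos σ)) := by
    field_simp
    ring
  rw [e, abs_div, abs_of_pos (mul_pos hc h3), div_le_iff₀ (mul_pos hc h3), abs_neg, abs_mul]
  have hi := inv_cosh_le y
  rw [div_le_iff₀ hc] at hi
  calc |Real.sinh y| * |Real.cos σ| ≤ Real.cosh y * 1 := by
        gcongr
        · exact abs_sinh_le_cosh y
        · exact Real.abs_cos_le_one σ
    _ ≤ Real.cosh y * (2 * Real.exp (-|y|) * Real.cosh y) := by gcongr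
    _ = 4 / (1 + θ) * Real.exp (-|y|) * (Real.cosh y * ((1 + θ) / 2 * Real.cosh y)) := by
        field_simp; ring
    _ ≤ _ := by gcongr

/-! ### Regular profiles and absolute convergence of the principal value -/

/-- The wave number `π / (2l)` of the strip of half-width `l`. -/
noncomputable def waveNumber (l : ℝ) : ℝ := Real.pi / (2 * l)

theorem waveNumber_pos {l : ℝ} (hl : 0 < l) : 0 < waveNumber l := by
  unfold waveNumber; positivity

theorem waveNumber_mul_lt {l m : ℝ} (hl : 0 < l) (hm : m < l) : waveNumber l * m < Real.pi / 2 := by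
  have : Real.pi / 2 = waveNumber l * l := by unfold waveNumber; field_simp
  rw [this]
  exact mul_lt_mul_of_pos_left hm (waveNumber_pos hl)

/-- A profile bounded by `m`, vanishing at infinity, whose derivative is bounded and Lipschitz with
constant `L`. -/
structure RegularProfile (m L : ℝ) (u : ℝ → ℝ) : Prop where
  differentiable : Differentiable ℝ u
  bound : ∀ x, |u x| ≤ m
  deriv_bound : ∀ x, |deriv u x| ≤ L
  deriv_lipschitz : ∀ x y, |deriv u x - deriv u y| ≤ L * |x - y|
  tendsto_zero : Tendsto u (cocompact ℝ) (𝓝 0)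

namespace RegularProfile

variable {l m L : ℝ} {u : ℝ → ℝ}

theorem bound_nonneg (hu : RegularProfile m L u) : 0 ≤ m := (abs_nonneg _).trans (hu.bound 0)

theorem lipschitz_nonneg (hu : RegularProfile m L u) : 0 ≤ L :=
  (abs_nonneg _).trans (hu.deriv_bound 0)

theorem continuous_deriv (hu : RegularProfile m L u) : Continuous (deriv u) := by
  refine (LipschitzWith.of_dist_le_mul (K := L.toNNReal) fun x y => ?_).continuous
  rw [Real.dist_eq, Real.dist_eq, Real.coe_toNNReal _ hu.lipschitz_nonneg]
  exact hu.deriv_lipschitz x y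

/-- Because m < l, the angle stays within 2μm < π of zero. This keeps the denominator of Ξ₂ away
from zero, even at η = 0. -/
theorem cos_sum_ge (hu : RegularProfile m L u) (hl : 0 < l) (hm : m < l) (x z : ℝ) :
    Real.cos (2 * (waveNumber l * m)) ≤ Real.cos (waveNumber l * (u x + u z)) := by
  rw [← Real.cos_abs (waveNumber l * (u x + u z))]
  have hμ := waveNumber_pos hl
  apply Real.cos_le_cos_of_nonneg_of_le_pi (abs_nonneg _)
  · linarith [waveNumber_mul_lt hl hm]
  · rw [abs_mul, abs_of_pos hμ]
    have h := abs_add_le (u x) (u z)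
    have h1 := hu.bound x
    have h2 := hu.bound z
    calc waveNumber l * |u x + u z| ≤ waveNumber l * (2 * m) := by gcongr; linarith
      _ = _ := by ring

theorem neg_one_lt_cos_two_mul (hl : 0 < l) (hm0 : 0 ≤ m) (hm : m < l) :
    -1 < Real.cos (2 * (waveNumber l * m)) := by
  have h1 := waveNumber_mul_lt hl hm
  have h2 := waveNumber_pos hl
  rw [← Real.cos_pi]
  exact Real.cos_lt_cos_of_nonneg_of_le_pi (by positivity) le_rfl (by linarith)

end RegularProfile

/-- The integrand of the internal wave equation with its odd part at infinity removed. -/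
noncomputable def reducedIntegrand (l : ℝ) (u : ℝ → ℝ) (x η : ℝ) : ℝ :=
  muskatIntegrand l u x η -
    2 * deriv u x * (Real.sinh (waveNumber l * η) / Real.cosh (waveNumber l * η))

/-- The constant in the exponential bound for `reducedIntegrand`. -/
noncomputable def kernelBound (l m L : ℝ) : ℝ :=
  3 * (4 * L / waveNumber l + 16 * L) + 8 * L / (1 + Real.cos (2 * (waveNumber l * m)))

section

variable {l m L : ℝ} {u : ℝ → ℝ}

/-- Near η = 0 the Lipschitz bound on u' compensates the 1/|η| singularity of Ξ₁; far away both
kernels are exponentially close to tanh. -/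
theorem abs_reducedIntegrand_le (hl : 0 < l) (hm : m < l) (hu : RegularProfile m L u) (x η : ℝ) :
    |reducedIntegrand l u x η| ≤ kernelBound l m L * Real.exp (-|waveNumber l * η|) := by
  have hμ := waveNumber_pos hl
  have hL := hu.lipschitz_nonneg
  set y := waveNumber l * η with hy
  set X1 := Xi1 l u x η
  set X2 := Xi2 l u x η
  set th := Real.sinh y / Real.cosh y
  have hX1 : X1 = Real.sinh y / (Real.cosh y - Real.cos (waveNumber l * (u x - u (x - η)))) := rfl
  have hX2 : X2 = Real.sinh y / (Real.cosh y + Real.cos (waveNumber l * (u x + u (x - η)))) := rfl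
  -- The coefficients of Ξ₁ and Ξ₂ add up to 2u'(x), so the removed term amounts to subtracting tanh
  -- from each kernel.
  have hred : reducedIntegrand l u x η =
      (deriv u x - deriv u (x - η)) * (X1 - th) + (deriv u x + deriv u (x - η)) * (X2 - th) := by
    change (deriv u x - deriv u (x - η)) * X1 + (deriv u x + deriv u (x - η)) * X2 -
      2 * deriv u x * th = _
    ring
  have hd2 : |deriv u x - deriv u (x - η)| ≤ 2 * L := by
    have := abs_sub (deriv u x) (deriv u (x - η))
    linarith [hu.deriv_bound x, hu.deriv_bound (x - η)]
  have hs2 : |deriv u x + deriv u (x - η)| ≤ 2 * L := by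
    have := abs_add_le (deriv u x) (deriv u (x - η))
    linarith [hu.deriv_bound x, hu.deriv_bound (x - η)]
  have hθ := RegularProfile.neg_one_lt_cos_two_mul hl hu.bound_nonneg hm
  have hB : |(deriv u x + deriv u (x - η)) * (X2 - th)| ≤
      8 * L / (1 + Real.cos (2 * (waveNumber l * m))) * Real.exp (-|y|) := by
    rw [abs_mul]
    have h1 := abs_regular_kernel_sub_tanh_le (y := y) (hu.cos_sum_ge hl hm x (x - η)) hθ
    rw [← hX2] at h1
    calc _ ≤ 2 * L * (4 / (1 + Real.cos (2 * (waveNumber l * m))) * Real.exp (-|y|)) := by gcongr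
      _ = _ := by ring
  have hA : |(deriv u x - deriv u (x - η)) * (X1 - th)| ≤
      3 * (4 * L / waveNumber l + 16 * L) * Real.exp (-|y|) := by
    apply le_envelope _ _ (by positivity)
    · intro h
      have h1 := abs_mul_singular_kernel_le (waveNumber l * (u x - u (x - η))) h
      rw [← hX1] at h1
      have hth : |th| ≤ 1 := by
        rw [abs_div, abs_of_pos (Real.cosh_pos y), div_le_one (Real.cosh_pos y)]
        exact abs_sinh_le_cosh y
      have h2 : |deriv u x - deriv u (x - η)| ≤ L * |y| / waveNumber l := by
        have := hu.deriv_lipschitz x (x - η)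
        rw [hy, abs_mul, abs_of_pos hμ]
        rw [sub_sub_cancel] at this
        calc _ ≤ _ := this
          _ = _ := by field_simp
      calc |(deriv u x - deriv u (x - η)) * (X1 - th)|
          ≤ |deriv u x - deriv u (x - η)| * |X1| + |deriv u x - deriv u (x - η)| * |th| := by
            rw [abs_mul, ← mul_add]; gcongr; exact abs_sub _ _
        _ ≤ L * |y| / waveNumber l * |X1| + 2 * L * 1 := by gcongr
        _ = L / waveNumber l * (|y| * |X1|) + 2 * L := by ring
        _ ≤ L / waveNumber l * 4 + 2 * L := by gcongr
        _ ≤ _ := by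
            have : L / waveNumber l * 4 = 4 * L / waveNumber l := by ring
            linarith
    · intro h
      have h1 := abs_singular_kernel_sub_tanh_le (waveNumber l * (u x - u (x - η))) h
      rw [← hX1] at h1
      have h4 : 0 ≤ 4 * L / waveNumber l := by positivity
      rw [abs_mul]
      calc _ ≤ 2 * L * (8 * Real.exp (-|y|)) := by gcongr
        _ = 16 * L * Real.exp (-|y|) := by ring
        _ ≤ _ := by gcongr; linarith
  rw [hred, kernelBound, add_mul (3 * _)]
  exact (abs_add_le (_ * _) (_ * _)).trans (add_le_add hA hB)

theorem measurable_reducedIntegrand (hu : RegularProfile m L u) :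
    Measurable fun p : ℝ × ℝ => reducedIntegrand l u p.1 p.2 := by
  have h1 := hu.differentiable.continuous.measurable
  have h2 := hu.continuous_deriv.measurable
  unfold reducedIntegrand muskatIntegrand Xi1 Xi2
  fun_prop

theorem integrable_reducedIntegrand (hl : 0 < l) (hm : m < l) (hu : RegularProfile m L u) (x : ℝ) :
    Integrable (reducedIntegrand l u x) := by
  refine ((integrable_exp_neg_mul_abs (waveNumber_pos hl)).const_mul (kernelBound l m L)).mono'
    ((measurable_reducedIntegrand hu).comp measurable_prodMk_left).aestronglyMeasurable
    (ae_of_all _ fun η => abs_reducedIntegrand_le hl hm hu x η)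

theorem setIntegral_eq_zero_of_odd {g : ℝ → ℝ} (hg : ∀ x, g (-x) = -g x) {S : Set ℝ}
    (hS : MeasurableSet S) (hneg : ∀ x, -x ∈ S ↔ x ∈ S) : ∫ x in S, g x = 0 := by
  rw [← integral_indicator hS]
  have h : ∀ x, S.indicator g (-x) = -S.indicator g x := by
    intro x
    by_cases hx : x ∈ S
    · rw [indicator_of_mem hx, indicator_of_mem ((hneg x).2 hx), hg]
    · rw [indicator_of_notMem hx, indicator_of_notMem (fun h => hx ((hneg x).1 h)), neg_zero]
  have h1 := integral_neg_eq_self (S.indicator g) volume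
  simp_rw [h] at h1
  rw [integral_neg] at h1
  linarith

/-- The principal value is the integral of the reduced integrand. -/
theorem HasPrincipalValue.eq_integral_reducedIntegrand (hl : 0 < l) (hm : m < l)
    (hu : RegularProfile m L u) {x p : ℝ} (hp : HasPrincipalValue (muskatIntegrand l u x) p) :
    p = ∫ η, reducedIntegrand l u x η := by
  have hmeas : ∀ ε R : ℝ, MeasurableSet {η : ℝ | ε < |η| ∧ |η| < R} := fun ε R =>
    (measurableSet_lt measurable_const measurable_id.abs).inter
      (measurableSet_lt measurable_id.abs measurable_const)
  have hint := integrable_reducedIntegrand hl hm hu x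
  -- The removed term is odd in η and the truncated region is symmetric, so it contributes nothing
  -- to any truncated integral.
  have htr : ∀ q : ℝ × ℝ, ∫ η in {η | q.1 < |η| ∧ |η| < q.2}, muskatIntegrand l u x η =
      ∫ η, {η | q.1 < |η| ∧ |η| < q.2}.indicator (reducedIntegrand l u x) η := by
    intro q
    rw [integral_indicator (hmeas _ _)]
    have hodd : ∫ η in {η | q.1 < |η| ∧ |η| < q.2}, 2 * deriv u x *
        (Real.sinh (waveNumber l * η) / Real.cosh (waveNumber l * η)) = 0 := by
      apply setIntegral_eq_zero_of_odd _ (hmeas _ _) (by simp)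
      intro η
      rw [mul_neg, Real.sinh_neg, Real.cosh_neg]
      ring
    have hodd_int : IntegrableOn (fun η => 2 * deriv u x *
        (Real.sinh (waveNumber l * η) / Real.cosh (waveNumber l * η)))
        {η | q.1 < |η| ∧ |η| < q.2} := by
      have hc : Continuous fun η => 2 * deriv u x *
          (Real.sinh (waveNumber l * η) / Real.cosh (waveNumber l * η)) :=
        continuous_const.mul (Continuous.div (by fun_prop) (by fun_prop)
          fun η => (Real.cosh_pos _).ne')
      refine (hc.integrableOn_Icc (a := -q.2) (b := q.2)).mono_set fun η hη => ?_
      exact abs_le.1 hη.2.le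
    have e : muskatIntegrand l u x = fun η => reducedIntegrand l u x η + 2 * deriv u x *
        (Real.sinh (waveNumber l * η) / Real.cosh (waveNumber l * η)) := by
      funext η
      simp [reducedIntegrand]
    rw [e, integral_add hint.integrableOn hodd_int, hodd, add_zero]
  have h1 := hp.tendsto
  simp_rw [htr] at h1
  refine tendsto_nhds_unique h1 ?_
  refine tendsto_integral_filter_of_dominated_convergence (fun η => |reducedIntegrand l u x η|)
    (Eventually.of_forall fun q => (hint.indicator (hmeas _ _)).aestronglyMeasurable)
    (Eventually.of_forall fun q => ae_of_all _ fun η => norm_indicator_le_norm_self _ _) hint.abs ?_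
  have h0 : ∀ᵐ η : ℝ, η ≠ 0 := by
    simp [ae_iff]
  filter_upwards [h0] with η hη
  apply tendsto_const_nhds.congr'
  have h2 : ∀ᶠ q : ℝ × ℝ in 𝓝[>] 0 ×ˢ atTop, q.1 < |η| ∧ |η| < q.2 :=
    (Filter.Eventually.prod_inl (mem_nhdsWithin_of_mem_nhds (Iio_mem_nhds (abs_pos.2 hη))) _).and
      (Filter.Eventually.prod_inr (Ioi_mem_atTop |η|) _)
  filter_upwards [h2] with q hq
  exact (indicator_of_mem (s := {η | q.1 < |η| ∧ |η| < q.2}) hq _).symm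

end

/-! ### The phase and its derivatives in position and in lag -/

/-- The angle whose `x`-derivative is, up to a factor, the integrand of the internal wave
equation. -/
noncomputable def phase (l : ℝ) (u : ℝ → ℝ) (x η : ℝ) : ℝ :=
  Real.arctan ((Real.sin (waveNumber l * u x) * Real.cosh (waveNumber l * η) -
    Real.sin (waveNumber l * u (x - η))) /
      (Real.sinh (waveNumber l * η) * Real.cos (waveNumber l * u x)))

/-- A sum of two squares is the denominator produced by differentiating the arctangent of a
quotient, as in `hasDerivAt_arctan_div`. -/
theorem denominator_factorization (U V y : ℝ) :
    (Real.cosh y - Real.cos (U - V)) * (Real.cosh y + Real.cos (U + V)) =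
      (Real.sin U * Real.cosh y - Real.sin V) ^ 2 + (Real.sinh y * Real.cos U) ^ 2 := by
  rw [Real.cos_sub, Real.cos_add]
  have h1 := Real.sin_sq_add_cos_sq U
  have h2 := Real.sin_sq_add_cos_sq V
  have h3 := Real.cosh_sq y
  linear_combination (Real.sin V ^ 2 - Real.cosh y ^ 2) * h1 - Real.cos U ^ 2 * h2 +
    Real.cos U ^ 2 * h3

theorem muskatIntegrand_eq {l : ℝ} {u : ℝ → ℝ} {x η : ℝ}
    (h1 : Real.cosh (waveNumber l * η) -
      Real.cos (waveNumber l * u x - waveNumber l * u (x - η)) ≠ 0)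
    (h2 : Real.cosh (waveNumber l * η) +
      Real.cos (waveNumber l * u x + waveNumber l * u (x - η)) ≠ 0) :
    muskatIntegrand l u x η = 2 * Real.sinh (waveNumber l * η) *
      ((Real.cosh (waveNumber l * η) - Real.sin (waveNumber l * u x) *
        Real.sin (waveNumber l * u (x - η))) * deriv u x -
        Real.cos (waveNumber l * u x) * Real.cos (waveNumber l * u (x - η)) * deriv u (x - η)) /
      ((Real.sin (waveNumber l * u x) * Real.cosh (waveNumber l * η) -
        Real.sin (waveNumber l * u (x - η))) ^ 2 +
        (Real.sinh (waveNumber l * η) * Real.cos (waveNumber l * u x)) ^ 2) := by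
  rw [← denominator_factorization]
  change (deriv u x - deriv u (x - η)) * (Real.sinh (waveNumber l * η) /
    (Real.cosh (waveNumber l * η) - Real.cos (waveNumber l * (u x - u (x - η))))) +
    (deriv u x + deriv u (x - η)) * (Real.sinh (waveNumber l * η) /
    (Real.cosh (waveNumber l * η) + Real.cos (waveNumber l * (u x + u (x - η))))) = _
  rw [mul_sub (waveNumber l) (u x), mul_add (waveNumber l) (u x)]
  have hsum : ∀ p q A B : ℝ, A ≠ 0 → B ≠ 0 → p * (Real.sinh (waveNumber l * η) / A) +
      q * (Real.sinh (waveNumber l * η) / B) =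
      Real.sinh (waveNumber l * η) * (p * B + q * A) / (A * B) := by
    intro p q A B hA hB
    field_simp
  rw [hsum _ _ _ _ h1 h2, Real.cos_sub, Real.cos_add]
  congr 1
  ring

theorem denominators_ne_zero {U V y : ℝ} (hU : Real.cos U ≠ 0) (hy : y ≠ 0) :
    Real.cosh y - Real.cos (U - V) ≠ 0 ∧ Real.cosh y + Real.cos (U + V) ≠ 0 := by
  rw [← mul_ne_zero_iff, denominator_factorization]
  have : Real.sinh y * Real.cos U ≠ 0 := mul_ne_zero (Real.sinh_ne_zero.2 hy) hU
  positivity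

theorem hasDerivAt_arctan_div {f g : ℝ → ℝ} {f' g' x : ℝ} (hf : HasDerivAt f f' x)
    (hg : HasDerivAt g g' x) (h0 : g x ≠ 0) :
    HasDerivAt (fun z => Real.arctan (f z / g z))
      ((f' * g x - f x * g') / (f x ^ 2 + g x ^ 2)) x := by
  convert! (hf.div hg h0).arctan using 1
  have : f x ^ 2 + g x ^ 2 ≠ 0 := by positivity
  have h1 : 1 + (f x / g x) ^ 2 ≠ 0 := by positivity
  simp only [Pi.div_apply]
  field_simp
  ring

section

variable {l : ℝ} {u : ℝ → ℝ} {x η : ℝ}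

theorem hasDerivAt_phase_space (hl : 0 < l) (hu : Differentiable ℝ u)
    (hc : Real.cos (waveNumber l * u x) ≠ 0) (hη : η ≠ 0) :
    HasDerivAt (fun z => phase l u z η) (waveNumber l / 2 * muskatIntegrand l u x η) x := by
  have hμ := waveNumber_pos hl
  have hy : waveNumber l * η ≠ 0 := mul_ne_zero hμ.ne' hη
  obtain ⟨h1, h2⟩ := denominators_ne_zero (V := waveNumber l * u (x - η)) hc hy
  have du := (hu x).hasDerivAt.const_mul (waveNumber l)
  have dv : HasDerivAt (fun z => waveNumber l * u (z - η)) (waveNumber l * deriv u (x - η)) x :=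
    ((hu (x - η)).hasDerivAt.comp_sub_const x η).const_mul _
  have := hasDerivAt_arctan_div ((du.sin.mul_const (Real.cosh (waveNumber l * η))).sub dv.sin)
    (du.cos.const_mul (Real.sinh (waveNumber l * η)))
    (mul_ne_zero (Real.sinh_ne_zero.2 hy) hc)
  convert! this using 1
  rw [muskatIntegrand_eq h1 h2]
  simp only [Pi.sub_apply]
  rw [mul_div_assoc']
  congr 1
  have e := Real.sin_sq_add_cos_sq (waveNumber l * u x)
  linear_combination (-waveNumber l * deriv u x * Real.sinh (waveNumber l * η) *
    Real.cosh (waveNumber l * η)) * e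

/-- The profile value at x - η contributes to the two derivatives of the phase with opposite signs.
At a critical point the remaining x-dependence is stationary, so only the explicit dependence on η
through cosh and sinh is left over. -/
theorem hasDerivAt_phase_lag (hl : 0 < l) (hu : Differentiable ℝ u)
    (hc : Real.cos (waveNumber l * u x) ≠ 0) (hη : η ≠ 0) (h0 : deriv u x = 0) :
    HasDerivAt (phase l u x) (waveNumber l / 2 *
      (2 * Real.cos (waveNumber l * u x) * (Real.sin (waveNumber l * u (x - η)) *
        Real.cosh (waveNumber l * η) - Real.sin (waveNumber l * u x)) /
      ((Real.sin (waveNumber l * u x) * Real.cosh (waveNumber l * η) -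
        Real.sin (waveNumber l * u (x - η))) ^ 2 +
        (Real.sinh (waveNumber l * η) * Real.cos (waveNumber l * u x)) ^ 2) -
      muskatIntegrand l u x η)) η := by
  have hμ := waveNumber_pos hl
  have hy : waveNumber l * η ≠ 0 := mul_ne_zero hμ.ne' hη
  obtain ⟨h1, h2⟩ := denominators_ne_zero (V := waveNumber l * u (x - η)) hc hy
  have dy : HasDerivAt (fun z => waveNumber l * z) (waveNumber l) η := by
    simpa using (hasDerivAt_id η).const_mul (waveNumber l)
  have dv : HasDerivAt (fun z => waveNumber l * u (x - z)) (waveNumber l * -deriv u (x - η)) η :=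
    ((hu (x - η)).hasDerivAt.comp_const_sub x η).const_mul _
  have := hasDerivAt_arctan_div
    ((dy.cosh.const_mul (Real.sin (waveNumber l * u x))).sub dv.sin)
    (dy.sinh.mul_const (Real.cos (waveNumber l * u x)))
    (mul_ne_zero (Real.sinh_ne_zero.2 hy) hc)
  convert! this using 1
  rw [muskatIntegrand_eq h1 h2, ← sub_div, mul_div_assoc', h0]
  simp only [Pi.sub_apply]
  congr 1
  have e := Real.cosh_sq (waveNumber l * η)
  linear_combination (waveNumber l * Real.sin (waveNumber l * u x) *
    Real.cos (waveNumber l * u x)) * e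

/-- The kernel of the nonlocal operator at a critical point of `u`. It has the sign of
`u x - u (x - η)`. -/
noncomputable def gapKernel (l : ℝ) (u : ℝ → ℝ) (x η : ℝ) : ℝ :=
  2 * Real.cos (waveNumber l * u x) *
    (Real.sin (waveNumber l * u x) - Real.sin (waveNumber l * u (x - η))) *
    (Real.cosh (waveNumber l * η) * (Real.cosh (waveNumber l * η) + 1) -
      Real.sin (waveNumber l * u x) *
        (Real.sin (waveNumber l * u x) + Real.sin (waveNumber l * u (x - η)))) /
    ((Real.cosh (waveNumber l * η) + 1 - 2 * Real.sin (waveNumber l * u x) ^ 2) *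
      ((Real.sin (waveNumber l * u x) * Real.cosh (waveNumber l * η) -
        Real.sin (waveNumber l * u (x - η))) ^ 2 +
        (Real.sinh (waveNumber l * η) * Real.cos (waveNumber l * u x)) ^ 2))

/-- The difference of the two sides is (cosh y - 1) sin² U. -/
theorem sin_sq_denominator_ge (U y : ℝ) :
    (Real.cosh y + 1) * Real.cos U ^ 2 ≤ Real.cosh y + 1 - 2 * Real.sin U ^ 2 := by
  rw [Real.cos_sq']
  nlinarith [mul_nonneg (sub_nonneg.2 (Real.one_le_cosh y)) (sq_nonneg (Real.sin U))]

/-- The constant profile has zero integrand and a phase with the same limits at infinity.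
Subtracting it cancels those limits and turns the explicit kernel into a multiple of sin U - sin V.
-/
theorem hasDerivAt_phase_sub (hl : 0 < l) (hu : Differentiable ℝ u)
    (hc : Real.cos (waveNumber l * u x) ≠ 0) (hη : η ≠ 0) (h0 : deriv u x = 0) :
    HasDerivAt (fun z => phase l u x z - phase l (fun _ => u x) x z)
      (-(waveNumber l / 2) * (gapKernel l u x η + muskatIntegrand l u x η)) η := by
  have hy : waveNumber l * η ≠ 0 := mul_ne_zero (waveNumber_pos hl).ne' hη
  have d1 := hasDerivAt_phase_lag hl hu hc hη h0
  have d2 := hasDerivAt_phase_lag (u := fun _ => u x) (x := x) hl (differentiable_const _) hc hη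
    (by simp)
  convert! d1.sub d2 using 1
  have hm : muskatIntegrand l (fun _ => u x) x η = 0 := by simp [muskatIntegrand]
  rw [hm]
  unfold gapKernel
  have hP := sin_sq_denominator_ge (waveNumber l * u x) (waveNumber l * η)
  have hD : (Real.sin (waveNumber l * u x) * Real.cosh (waveNumber l * η) -
        Real.sin (waveNumber l * u (x - η))) ^ 2 +
        (Real.sinh (waveNumber l * η) * Real.cos (waveNumber l * u x)) ^ 2 ≠ 0 := by
    rw [← denominator_factorization]
    obtain ⟨h1, h2⟩ := denominators_ne_zero (V := waveNumber l * u (x - η)) hc hy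
    exact mul_ne_zero h1 h2
  have hD0 : (Real.sin (waveNumber l * u x) * Real.cosh (waveNumber l * η) -
        Real.sin (waveNumber l * u x)) ^ 2 +
        (Real.sinh (waveNumber l * η) * Real.cos (waveNumber l * u x)) ^ 2 ≠ 0 := by
    rw [← denominator_factorization]
    obtain ⟨h1, h2⟩ := denominators_ne_zero (V := waveNumber l * u x) hc hy
    exact mul_ne_zero h1 h2
  have hc1 : 0 < Real.cosh (waveNumber l * η) - 1 :=
    sub_pos.2 (Real.one_lt_cosh.2 hy)
  have e1 := Real.cosh_sq (waveNumber l * η)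
  have e2 := Real.sin_sq_add_cos_sq (waveNumber l * u x)
  have hP0 : Real.cosh (waveNumber l * η) + 1 - 2 * Real.sin (waveNumber l * u x) ^ 2 ≠ 0 := by
    have : 0 < (Real.cosh (waveNumber l * η) + 1) * Real.cos (waveNumber l * u x) ^ 2 := by
      positivity
    linarith
  -- For the constant profile the factor cosh y - 1 cancels against the numerator; what remains is
  -- the extra factor in the denominator of `gapKernel`.
  have hfac : (Real.sin (waveNumber l * u x) * Real.cosh (waveNumber l * η) -
        Real.sin (waveNumber l * u x)) ^ 2 +
        (Real.sinh (waveNumber l * η) * Real.cos (waveNumber l * u x)) ^ 2 =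
      (Real.cosh (waveNumber l * η) - 1) *
        (Real.cosh (waveNumber l * η) + 1 - 2 * Real.sin (waveNumber l * u x) ^ 2) := by
    linear_combination (-Real.cos (waveNumber l * u x) ^ 2) * e1 +
      (Real.cosh (waveNumber l * η) ^ 2 - 1) * e2
  rw [hfac]
  have hsq : (Real.sinh (waveNumber l * η) * Real.cos (waveNumber l * u x)) ^ 2 =
      (Real.cosh (waveNumber l * η) ^ 2 - 1) * (1 - Real.sin (waveNumber l * u x) ^ 2) := by
    rw [mul_pow, e1, Real.cos_sq']; ring
  rw [hsq] at hD ⊢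
  generalize Real.sin (waveNumber l * u x) = a at *
  generalize Real.sin (waveNumber l * u (x - η)) = b at *
  generalize Real.cosh (waveNumber l * η) = c at *
  have hc1' := hc1.ne'
  field_simp
  ring

end

/-! ### The phase at infinity -/

theorem abs_arctan_sub_arctan_le (x y : ℝ) : |Real.arctan x - Real.arctan y| ≤ |x - y| := by
  have := Convex.norm_image_sub_le_of_norm_hasDerivWithin_le (s := univ) (C := 1) (x := y) (y := x)
    (fun z _ => (Real.hasDerivAt_arctan z).hasDerivWithinAt) (fun z _ => by
      rw [Real.norm_eq_abs, abs_of_pos (by positivity), div_le_one (by positivity)]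
      nlinarith [sq_nonneg z]) convex_univ (mem_univ _) (mem_univ _)
  simpa only [Real.norm_eq_abs, one_mul] using this

theorem abs_arctan_le_pi_div_two (x : ℝ) : |Real.arctan x| ≤ Real.pi / 2 :=
  abs_le.2 ⟨(Real.neg_pi_div_two_lt_arctan x).le, (Real.arctan_lt_pi_div_two x).le⟩

theorem exp_le_four_mul_sinh {y : ℝ} (hy : 1 ≤ y) : Real.exp y ≤ 4 * Real.sinh y := by
  rw [Real.sinh_eq]
  have h1 : Real.exp 1 ≤ Real.exp y := Real.exp_le_exp.2 hy
  have h2 : Real.exp (-y) ≤ 1 := Real.exp_le_one_iff.2 (by linarith)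
  have h3 := Real.exp_one_gt_d9
  linarith

/-- As y grows the quotient tends exponentially fast to tan U, and arctan is 1-Lipschitz; U tanh y
also tends exponentially fast to U. -/
theorem abs_arctan_sub_le_of_one_le {U b y c₀ : ℝ} (hU : |U| < Real.pi / 2) (hb : |b| ≤ 1)
    (hc₀ : 0 < c₀) (hc : c₀ ≤ Real.cos U) (hy : 1 ≤ y) :
    |Real.arctan ((Real.sin U * Real.cosh y - b) / (Real.sinh y * Real.cos U)) -
      U * (Real.sinh y / Real.cosh y)| ≤ (2 + 8 / c₀) * Real.exp (-y) := by
  have hcU := hc₀.trans_le hc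
  have hs : 0 < Real.sinh y := Real.sinh_pos_iff.2 (by linarith)
  have hch := Real.cosh_pos y
  have hU' := abs_lt.1 hU
  have he : Real.exp (-y) = Real.cosh y - Real.sinh y := (Real.cosh_sub_sinh y).symm
  have hpe := Real.exp_pos (-y)
  have h1 : |Real.arctan ((Real.sin U * Real.cosh y - b) / (Real.sinh y * Real.cos U)) - U| ≤
      8 / c₀ * Real.exp (-y) := by
    have h0 := abs_arctan_sub_arctan_le
      ((Real.sin U * Real.cosh y - b) / (Real.sinh y * Real.cos U)) (Real.tan U)
    rw [Real.arctan_tan hU'.1 hU'.2] at h0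
    refine h0.trans ?_
    rw [Real.tan_eq_sin_div_cos]
    have e : (Real.sin U * Real.cosh y - b) / (Real.sinh y * Real.cos U) -
        Real.sin U / Real.cos U = (Real.sin U * Real.exp (-y) - b) / (Real.sinh y * Real.cos U) := by
      rw [he]; field_simp; ring
    have hn : |Real.sin U * Real.exp (-y) - b| ≤ 2 := by
      refine (abs_sub _ _).trans ?_
      have h5 : |Real.sin U * Real.exp (-y)| ≤ 1 * 1 := by
        rw [abs_mul, abs_of_pos hpe]
        gcongr
        · exact Real.abs_sin_le_one U
        · exact Real.exp_le_one_iff.2 (by linarith)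
      linarith
    rw [e, abs_div, abs_of_pos (mul_pos hs hcU)]
    have h4 := exp_le_four_mul_sinh hy
    calc _ ≤ 2 / (Real.exp y / 4 * c₀) := by gcongr; linarith
      _ = _ := by rw [Real.exp_neg]; field_simp; norm_num
  have h2 : |U - U * (Real.sinh y / Real.cosh y)| ≤ 2 * Real.exp (-y) := by
    have e : U - U * (Real.sinh y / Real.cosh y) = U * (Real.exp (-y) / Real.cosh y) := by
      rw [he]; field_simp
    rw [e, abs_mul, abs_of_pos (div_pos hpe hch)]
    have h3 : |U| ≤ 2 := by linarith [Real.pi_le_four]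
    have h4 : Real.exp (-y) / Real.cosh y ≤ Real.exp (-y) :=
      div_le_self hpe.le (Real.one_le_cosh y)
    gcongr
  calc _ ≤ _ := abs_sub_le _ U _
    _ ≤ 8 / c₀ * Real.exp (-y) + 2 * Real.exp (-y) := add_le_add h1 h2
    _ = _ := by ring

theorem abs_arctan_sub_le {U b y c₀ : ℝ} (hU : |U| < Real.pi / 2) (hb : |b| ≤ 1)
    (hc₀ : 0 < c₀) (hc : c₀ ≤ Real.cos U) :
    |Real.arctan ((Real.sin U * Real.cosh y - b) / (Real.sinh y * Real.cos U)) -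
      U * (Real.sinh y / Real.cosh y)| ≤ 3 * (4 + 8 / c₀) * Real.exp (-|y|) := by
  apply le_envelope _ _ (by positivity)
  · intro _
    have h1 := abs_arctan_le_pi_div_two
      ((Real.sin U * Real.cosh y - b) / (Real.sinh y * Real.cos U))
    have h2 : |U * (Real.sinh y / Real.cosh y)| ≤ Real.pi / 2 * 1 := by
      rw [abs_mul, abs_div, abs_of_pos (Real.cosh_pos y)]
      have := abs_sinh_le_cosh y
      gcongr
      exact div_le_one_of_le₀ this (Real.cosh_pos y).le
    have h3 : 0 ≤ 8 / c₀ := by positivity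
    have := abs_sub (Real.arctan ((Real.sin U * Real.cosh y - b) / (Real.sinh y * Real.cos U)))
      (U * (Real.sinh y / Real.cosh y))
    linarith [Real.pi_le_four]
  · intro hy
    have hp := Real.exp_pos (-|y|)
    refine le_trans ?_ (mul_le_mul_of_nonneg_right
      (by linarith : 2 + 8 / c₀ ≤ 4 + 8 / c₀) hp.le)
    rcases le_abs'.1 hy with h | h
    -- The quotient and tanh are odd in y, so negative y reduces to -y.
    · have := abs_arctan_sub_le_of_one_le hU hb hc₀ hc (y := -y) (by linarith)
      rw [Real.cosh_neg, Real.sinh_neg, neg_mul, div_neg, Real.arctan_neg, neg_div, mul_neg,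
        sub_neg_eq_add, neg_add_eq_sub, abs_sub_comm] at this
      rwa [abs_of_neg (a := y) (by linarith)]
    · rw [abs_of_pos (a := y) (by linarith)]
      exact abs_arctan_sub_le_of_one_le hU hb hc₀ hc h

section

variable {l m L : ℝ} {u : ℝ → ℝ} {x : ℝ}

theorem abs_waveNumber_mul_lt (hl : 0 < l) (hm : m < l) (hx : |u x| ≤ m) :
    |waveNumber l * u x| < Real.pi / 2 := by
  have hμ := waveNumber_pos hl
  rw [abs_mul, abs_of_pos hμ]
  exact (mul_le_mul_of_nonneg_left hx hμ.le).trans_lt (waveNumber_mul_lt hl hm)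

theorem cos_waveNumber_mul_ge (hl : 0 < l) (hm : m < l) (hx : |u x| ≤ m) :
    Real.cos (waveNumber l * m) ≤ Real.cos (waveNumber l * u x) := by
  have hμ := waveNumber_pos hl
  rw [← Real.cos_abs (waveNumber l * u x)]
  apply Real.cos_le_cos_of_nonneg_of_le_pi (abs_nonneg _)
  · linarith [waveNumber_mul_lt hl hm, Real.pi_pos]
  · rw [abs_mul, abs_of_pos hμ]
    gcongr

theorem cos_waveNumber_mul_pos (hl : 0 < l) (hm0 : 0 ≤ m) (hm : m < l) :
    0 < Real.cos (waveNumber l * m) :=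
  Real.cos_pos_of_mem_Ioo ⟨by
    have := mul_nonneg (waveNumber_pos hl).le hm0
    linarith [Real.pi_pos], waveNumber_mul_lt hl hm⟩

theorem abs_phase_sub_le (hl : 0 < l) (hm : m < l) (hx : |u x| ≤ m) (η : ℝ) :
    |phase l u x η - waveNumber l * u x *
      (Real.sinh (waveNumber l * η) / Real.cosh (waveNumber l * η))| ≤
      3 * (4 + 8 / Real.cos (waveNumber l * m)) * Real.exp (-|waveNumber l * η|) :=
  abs_arctan_sub_le (abs_waveNumber_mul_lt hl hm hx) (Real.abs_sin_le_one _)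
    (cos_waveNumber_mul_pos hl ((abs_nonneg _).trans hx) hm) (cos_waveNumber_mul_ge hl hm hx)

/-! ### The gap kernel and the principal value at a critical point -/

theorem RegularProfile.abs_sub_le_sq (hu : RegularProfile m L u) (h0 : deriv u x = 0) (η : ℝ) :
    |u x - u (x - η)| ≤ L * η ^ 2 := by
  have := Convex.norm_image_sub_le_of_norm_deriv_le (f := u) (s := uIcc x (x - η)) (C := L * |η|)
    (fun z _ => hu.differentiable z) (fun z hz => by
      have h1 := hu.deriv_lipschitz z x
      rw [h0, sub_zero] at h1
      have h2 := abs_sub_left_of_mem_uIcc hz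
      rw [Real.norm_eq_abs]
      refine h1.trans ?_
      have hL := hu.lipschitz_nonneg
      refine mul_le_mul_of_nonneg_left ?_ hL
      simpa using h2) (convex_uIcc _ _) right_mem_uIcc left_mem_uIcc
  rw [sub_sub_cancel, Real.norm_eq_abs, Real.norm_eq_abs, mul_assoc, ← sq, sq_abs] at this
  exact this

theorem abs_sin_sub_sin_le (a b : ℝ) : |Real.sin a - Real.sin b| ≤ |a - b| := by
  have := Convex.norm_image_sub_le_of_norm_hasDerivWithin_le (s := univ) (C := 1) (x := b) (y := a)
    (fun z _ => (Real.hasDerivAt_sin z).hasDerivWithinAt) (fun z _ => by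
      rw [Real.norm_eq_abs]; exact Real.abs_cos_le_one z) convex_univ (mem_univ _) (mem_univ _)
  simpa only [Real.norm_eq_abs, one_mul] using this

theorem abs_sin_gap_le (hl : 0 < l) (hu : RegularProfile m L u) (h0 : deriv u x = 0) (η : ℝ) :
    |Real.sin (waveNumber l * u x) - Real.sin (waveNumber l * u (x - η))| ≤
      L / waveNumber l * (waveNumber l * η) ^ 2 := by
  have hμ := waveNumber_pos hl
  refine (abs_sin_sub_sin_le _ _).trans ?_
  rw [← mul_sub, abs_mul, abs_of_pos hμ]
  calc _ ≤ waveNumber l * (L * η ^ 2) := by gcongr; exact hu.abs_sub_le_sq h0 η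
    _ = _ := by field_simp

/-- With c = cosh y and k = cos U, the bracket in the numerator is at most 4(c+1)², and the two
factors of the denominator are at least (c+1)k² and (c²-1)k². -/
theorem abs_gapKernel_le_div (hc : 0 < Real.cos (waveNumber l * u x)) {η : ℝ}
    (hy : waveNumber l * η ≠ 0) :
    |gapKernel l u x η| ≤
      8 * |Real.sin (waveNumber l * u x) - Real.sin (waveNumber l * u (x - η))| /
        (Real.cos (waveNumber l * u x) ^ 3 * (Real.cosh (waveNumber l * η) - 1)) := by
  have hP := sin_sq_denominator_ge (waveNumber l * u x) (waveNumber l * η)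
  have hc1 : 0 < Real.cosh (waveNumber l * η) - 1 := sub_pos.2 (Real.one_lt_cosh.2 hy)
  have e1 : Real.sinh (waveNumber l * η) ^ 2 =
      (Real.cosh (waveNumber l * η) - 1) * (Real.cosh (waveNumber l * η) + 1) := by
    have := Real.cosh_sq (waveNumber l * η)
    linarith
  have ha := Real.abs_sin_le_one (waveNumber l * u x)
  have hb := Real.abs_sin_le_one (waveNumber l * u (x - η))
  unfold gapKernel
  rw [mul_pow, e1]
  generalize Real.sin (waveNumber l * u x) = a at *
  generalize Real.sin (waveNumber l * u (x - η)) = b at *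
  generalize Real.cosh (waveNumber l * η) = c at *
  generalize Real.cos (waveNumber l * u x) = k at *
  have hb1 : |c * (c + 1) - a * (a + b)| ≤ 4 * (c + 1) ^ 2 := by
    have h1 : |a * (a + b)| ≤ 1 * (1 + 1) := by
      rw [abs_mul]
      gcongr
      exact (abs_add_le _ _).trans (add_le_add ha hb)
    have h2 := abs_sub (c * (c + 1)) (a * (a + b))
    rw [abs_of_pos (by nlinarith : 0 < c * (c + 1))] at h2
    nlinarith
  have hD : (c - 1) * (c + 1) * k ^ 2 ≤ (a * c - b) ^ 2 + (c - 1) * (c + 1) * k ^ 2 := by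
    nlinarith [sq_nonneg (a * c - b)]
  have hc2 : 0 < c + 1 := by linarith
  have hden : 0 < (c + 1) * k ^ 2 * ((c - 1) * (c + 1) * k ^ 2) := by positivity
  rw [abs_div, abs_mul, abs_mul, abs_of_pos (by positivity : 0 < 2 * k)]
  have hle : (c + 1) * k ^ 2 * ((c - 1) * (c + 1) * k ^ 2) ≤
      |(c + 1 - 2 * a ^ 2) * ((a * c - b) ^ 2 + (c - 1) * (c + 1) * k ^ 2)| := by
    refine le_trans ?_ (le_abs_self _)
    have : 0 < (c + 1) * k ^ 2 := by positivity
    gcongr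
    exact this.le.trans hP
  calc _ ≤ 2 * k * |a - b| * (4 * (c + 1) ^ 2) /
        ((c + 1) * k ^ 2 * ((c - 1) * (c + 1) * k ^ 2)) := by gcongr
    _ = _ := by field_simp; ring

/-- Near zero the gap of sines is O(y²) at a critical point, which cancels cosh y - 1 ≥ y²/2; far
away 1/(cosh y - 1) decays exponentially. -/
theorem exists_abs_gapKernel_le (hl : 0 < l) (hm : m < l) (hu : RegularProfile m L u)
    (h0 : deriv u x = 0) :
    ∃ K, ∀ η, |gapKernel l u x η| ≤ K * Real.exp (-|waveNumber l * η|) := by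
  have hμ := waveNumber_pos hl
  have hL := hu.lipschitz_nonneg
  have hc : 0 < Real.cos (waveNumber l * u x) :=
    (cos_waveNumber_mul_pos hl hu.bound_nonneg hm).trans_le
      (cos_waveNumber_mul_ge hl hm (hu.bound x))
  set k := Real.cos (waveNumber l * u x)
  refine ⟨3 * (16 * L / (waveNumber l * k ^ 3) + 128 / k ^ 3), fun η => ?_⟩
  have hA : 0 ≤ 16 * L / (waveNumber l * k ^ 3) := by positivity
  have hB : 0 ≤ 128 / k ^ 3 := by positivity
  rcases eq_or_ne η 0 with rfl | hη
  · have : gapKernel l u x 0 = 0 := by simp [gapKernel]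
    rw [this, abs_zero]
    positivity
  have hy : waveNumber l * η ≠ 0 := mul_ne_zero hμ.ne' hη
  have hg := abs_gapKernel_le_div hc hy
  have hy2 : 0 < (waveNumber l * η) ^ 2 := by positivity
  apply le_envelope _ _ (by positivity)
  · intro _
    calc _ ≤ _ := hg
      _ ≤ 8 * (L / waveNumber l * (waveNumber l * η) ^ 2) / (k ^ 3 * ((waveNumber l * η) ^ 2 / 2)) := by
        gcongr
        · exact abs_sin_gap_le hl hu h0 η
        · exact half_sq_le_cosh_sub_one _
      _ = 16 * L / (waveNumber l * k ^ 3) := by field_simp; ring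
      _ ≤ _ := by linarith
  · intro h1
    have h2 : |Real.sin (waveNumber l * u x) - Real.sin (waveNumber l * u (x - η))| ≤ 2 := by
      have := abs_sub (Real.sin (waveNumber l * u x)) (Real.sin (waveNumber l * u (x - η)))
      linarith [Real.abs_sin_le_one (waveNumber l * u x),
        Real.abs_sin_le_one (waveNumber l * u (x - η))]
    calc _ ≤ _ := hg
      _ ≤ 8 * 2 / (k ^ 3 * (Real.exp |waveNumber l * η| / 8)) := by
        gcongr
        exact exp_abs_le_cosh_sub_one h1
      _ = 128 / k ^ 3 * Real.exp (-|waveNumber l * η|) := by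
        rw [Real.exp_neg]; field_simp; norm_num
      _ ≤ _ := by gcongr; linarith

theorem integrable_gapKernel (hl : 0 < l) (hm : m < l) (hu : RegularProfile m L u)
    (h0 : deriv u x = 0) : Integrable (gapKernel l u x) := by
  obtain ⟨K, hK⟩ := exists_abs_gapKernel_le hl hm hu h0
  refine ((integrable_exp_neg_mul_abs (waveNumber_pos hl)).const_mul K).mono' ?_ (ae_of_all _ hK)
  have h1 := hu.differentiable.continuous.measurable
  have : Measurable (gapKernel l u x) := by
    unfold gapKernel
    fun_prop
  exact this.aestronglyMeasurable

theorem tendsto_exp_neg_abs_zero (hl : 0 < l) (K : ℝ) :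
    Tendsto (fun η => K * Real.exp (-|waveNumber l * η|)) (cocompact ℝ) (𝓝 0) := by
  rw [← mul_zero K]
  refine (Real.tendsto_exp_neg_atTop_nhds_zero.comp ?_).const_mul K
  have h1 : Tendsto (fun η : ℝ => waveNumber l * |η|) (cocompact ℝ) atTop :=
    (tendsto_norm_cocompact_atTop (E := ℝ)).const_mul_atTop (waveNumber_pos hl)
  refine h1.congr fun η => ?_
  rw [abs_mul, abs_of_pos (waveNumber_pos hl)]

theorem tendsto_phase_sub_zero (hl : 0 < l) (hm : m < l) (hx : |u x| ≤ m) :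
    Tendsto (fun η => phase l u x η - phase l (fun _ => u x) x η) (cocompact ℝ) (𝓝 0) := by
  have key : ∀ v : ℝ → ℝ, v x = u x → Tendsto (fun η => phase l v x η - waveNumber l * u x *
      (Real.sinh (waveNumber l * η) / Real.cosh (waveNumber l * η))) (cocompact ℝ) (𝓝 0) := by
    intro v hv
    rw [← hv] at hx ⊢
    exact squeeze_zero_norm (fun η => abs_phase_sub_le hl hm hx η) (tendsto_exp_neg_abs_zero hl _)
  have := (key u rfl).sub (key (fun _ => u x) rfl)
  simpa using this

/-- The numerator is O(y²) while the denominator is of order y, so the phase tends to 0. This agrees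
with its value at 0, where the quotient 0/0 is 0 by convention. -/
theorem continuousAt_phase_zero (hl : 0 < l) (hc : 0 < Real.cos (waveNumber l * u x)) {K : ℝ}
    (hK : ∀ η, |Real.sin (waveNumber l * u x) - Real.sin (waveNumber l * u (x - η))| ≤
      K * (waveNumber l * η) ^ 2) : ContinuousAt (phase l u x) 0 := by
  have hK0 : 0 ≤ K := by
    have := (abs_nonneg _).trans (hK (1 / waveNumber l))
    rw [mul_one_div_cancel (waveNumber_pos hl).ne'] at this
    linarith
  have hz : phase l u x 0 = 0 := by simp [phase]
  unfold ContinuousAt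
  rw [hz]
  refine squeeze_zero_norm (a := fun η => (|Real.sinh (waveNumber l * η)| +
    K * |waveNumber l * η|) / Real.cos (waveNumber l * u x)) (fun η => ?_) ?_
  · rw [Real.norm_eq_abs]
    unfold phase
    have h1 := abs_arctan_sub_arctan_le ((Real.sin (waveNumber l * u x) *
      Real.cosh (waveNumber l * η) - Real.sin (waveNumber l * u (x - η))) /
      (Real.sinh (waveNumber l * η) * Real.cos (waveNumber l * u x))) 0
    rw [Real.arctan_zero, sub_zero, sub_zero] at h1
    refine h1.trans ?_
    rw [abs_div, abs_mul, abs_of_pos hc, ← div_div]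
    gcongr
    rcases eq_or_ne (waveNumber l * η) 0 with h | h
    · simp [h]
    have hs : 0 < |Real.sinh (waveNumber l * η)| := abs_pos.2 (Real.sinh_ne_zero.2 h)
    rw [div_le_iff₀ hs]
    have e1 : |Real.sinh (waveNumber l * η)| * |Real.sinh (waveNumber l * η)| =
        (Real.cosh (waveNumber l * η) - 1) * (Real.cosh (waveNumber l * η) + 1) := by
      have := Real.cosh_sq (waveNumber l * η)
      rw [← sq, sq_abs]
      linarith
    have hc1 := Real.one_le_cosh (waveNumber l * η)
    have hys : |waveNumber l * η| ≤ |Real.sinh (waveNumber l * η)| := by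
      rw [Real.abs_sinh]
      exact Real.self_le_sinh_iff.2 (abs_nonneg _)
    have e : Real.sin (waveNumber l * u x) * Real.cosh (waveNumber l * η) -
        Real.sin (waveNumber l * u (x - η)) =
        Real.sin (waveNumber l * u x) * (Real.cosh (waveNumber l * η) - 1) +
        (Real.sin (waveNumber l * u x) - Real.sin (waveNumber l * u (x - η))) := by ring
    rw [e, add_mul, e1]
    refine (abs_add_le _ _).trans (add_le_add ?_ ?_)
    · rw [abs_mul, abs_of_nonneg (sub_nonneg.2 hc1)]
      have := Real.abs_sin_le_one (waveNumber l * u x)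
      nlinarith
    · refine (hK η).trans ?_
      rw [mul_assoc, ← sq_abs, sq]
      gcongr
  · have : Continuous fun η => (|Real.sinh (waveNumber l * η)| +
        K * |waveNumber l * η|) / Real.cos (waveNumber l * u x) := by fun_prop
    simpa using this.tendsto 0

/-- At a critical point the principal value is minus the integral of the gap kernel. -/
theorem HasPrincipalValue.eq_neg_integral_gapKernel (hl : 0 < l) (hm : m < l)
    (hu : RegularProfile m L u) (h0 : deriv u x = 0) {p : ℝ}
    (hp : HasPrincipalValue (muskatIntegrand l u x) p) : p = -∫ η, gapKernel l u x η := by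
  have hμ := waveNumber_pos hl
  have hc : 0 < Real.cos (waveNumber l * u x) :=
    (cos_waveNumber_mul_pos hl hu.bound_nonneg hm).trans_le
      (cos_waveNumber_mul_ge hl hm (hu.bound x))
  have hred : reducedIntegrand l u x = muskatIntegrand l u x := by
    funext η
    simp [reducedIntegrand, h0]
  have hi1 := integrable_reducedIntegrand hl hm hu x
  have hp' := hp.eq_integral_reducedIntegrand hl hm hu
  rw [hred] at hi1 hp'
  have hi2 := integrable_gapKernel hl hm hu h0
  have hi : Integrable fun η => -(waveNumber l / 2) *
      (gapKernel l u x η + muskatIntegrand l u x η) := (hi2.add hi1).const_mul _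
  set Q := fun η => phase l u x η - phase l (fun _ => u x) x η
  have hQ0 : Q 0 = 0 := by simp [Q, phase]
  have hcont : ContinuousAt Q 0 :=
    (continuousAt_phase_zero hl hc (abs_sin_gap_le hl hu h0)).sub
      (continuousAt_phase_zero (K := 0) hl hc (by simp))
  have hd : ∀ η ≠ 0, HasDerivAt Q _ η := fun η hη =>
    hasDerivAt_phase_sub hl hu.differentiable hc.ne' hη h0
  have hlim := tendsto_phase_sub_zero hl hm (hu.bound x)
  -- The fundamental theorem of calculus on the two half-lines: `Q` vanishes at the origin and at
  -- both ends.
  have hz : ∫ η, -(waveNumber l / 2) * (gapKernel l u x η + muskatIntegrand l u x η) = 0 := by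
    rw [← setIntegral_univ, ← Iic_union_Ioi (a := (0 : ℝ)), setIntegral_union
      (Iic_disjoint_Ioi le_rfl) measurableSet_Ioi hi.integrableOn hi.integrableOn,
      integral_Ioi_of_hasDerivAt_of_tendsto hcont.continuousWithinAt
        (fun η hη => hd η (ne_of_gt hη)) hi.integrableOn (hlim.mono_left atTop_le_cocompact),
      integral_Iic_of_hasDerivAt_of_tendsto hcont.continuousWithinAt
        (fun η hη => hd η (ne_of_lt hη)) hi.integrableOn (hlim.mono_left atBot_le_cocompact), hQ0]
    simp
  rw [integral_const_mul, integral_add hi2 hi1, ← hp'] at hz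
  rcases mul_eq_zero.1 hz with h | h
  · linarith
  · linarith

end

/-! ### Sign and lower bound of the gap kernel at a maximum -/

section

variable {l m L : ℝ} {u : ℝ → ℝ} {x : ℝ}

/-- Sine is increasing on [-π/2, π/2], so the gap of sines is nonnegative; the other bracket is
nonnegative because cosh y (cosh y + 1) ≥ 2. -/
theorem gapKernel_nonneg (hl : 0 < l) (hm : m < l) (hu : RegularProfile m L u) {η : ℝ}
    (h : u (x - η) ≤ u x) : 0 ≤ gapKernel l u x η := by
  have hμ := waveNumber_pos hl
  have hx := abs_le.1 (abs_waveNumber_mul_lt (x := x) hl hm (hu.bound x)).le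
  have hz := abs_le.1 (abs_waveNumber_mul_lt (x := x - η) hl hm (hu.bound _)).le
  have hab := Real.sin_le_sin_of_le_of_le_pi_div_two hz.1 hx.2 (mul_le_mul_of_nonneg_left h hμ.le)
  have hc : 0 ≤ Real.cos (waveNumber l * u x) := Real.cos_nonneg_of_mem_Icc hx
  have hP := sin_sq_denominator_ge (waveNumber l * u x) (waveNumber l * η)
  have hc1 := Real.one_le_cosh (waveNumber l * η)
  have ha := abs_le.1 (Real.abs_sin_le_one (waveNumber l * u x))
  have hb := abs_le.1 (Real.abs_sin_le_one (waveNumber l * u (x - η)))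
  unfold gapKernel
  apply div_nonneg
  · apply mul_nonneg (mul_nonneg (by positivity) (sub_nonneg.2 hab))
    nlinarith
  · apply mul_nonneg _ (by positivity)
    exact le_trans (by positivity) hP

/-- The difference equals sin(U/2)(2 cos(U/2) - 1), where sin(U/2) ≥ U/4 by Jordan's inequality and
cos(U/2) ≥ cos(π/4) ≥ 7/10. -/
theorem sin_sub_sin_half_ge {U : ℝ} (h0 : 0 ≤ U) (h1 : U ≤ Real.pi / 2) :
    U / 10 ≤ Real.sin U - Real.sin (U / 2) := by
  have e : Real.sin U - Real.sin (U / 2) = Real.sin (U / 2) * (2 * Real.cos (U / 2) - 1) := by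
    have := Real.sin_two_mul (U / 2)
    rw [mul_div_cancel₀ U two_ne_zero] at this
    rw [this]; ring
  have hs : U / 4 ≤ Real.sin (U / 2) := by
    have := Real.mul_le_sin (x := U / 2) (by linarith) (by linarith [Real.pi_pos])
    have h4 : 1 / 2 ≤ 2 / Real.pi := by
      rw [div_le_div_iff₀ two_pos Real.pi_pos]
      linarith [Real.pi_le_four]
    nlinarith
  have hc : 7 / 10 ≤ Real.cos (U / 2) := by
    have h5 : Real.cos (Real.pi / 4) ≤ Real.cos (U / 2) :=
      Real.cos_le_cos_of_nonneg_of_le_pi (by linarith) (by linarith [Real.pi_pos]) (by linarith)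
    rw [Real.cos_pi_div_four] at h5
    have h6 : 1.4 ≤ √2 := Real.le_sqrt_of_sq_le (by norm_num)
    linarith
  rw [e]
  nlinarith

/-- The two factors of the denominator are at most 2c and 2c², and the last bracket of the numerator
is at least k²c². -/
theorem gap_fraction_lower_bound {a b c k : ℝ} (hk : 0 < k) (hak : a ^ 2 + k ^ 2 = 1) (hb : 0 ≤ b)
    (hab : b < a) (ha : a ≤ 1) (hc : 1 < c) :
    k ^ 3 * (a - b) / (2 * c) ≤ 2 * k * (a - b) * (c * (c + 1) - a * (a + b)) /
      ((c + 1 - 2 * a ^ 2) * ((a * c - b) ^ 2 + (c ^ 2 - 1) * k ^ 2)) := by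
  have hab' : 0 < a - b := sub_pos.2 hab
  have ha0 : 0 < a := hb.trans_lt hab
  have hc0 : 0 < c := by linarith
  have ha2 : a ^ 2 ≤ 1 := pow_le_one₀ ha0.le ha
  have hk2 : k ^ 2 ≤ 1 := by linarith [sq_nonneg a]
  have hk0 : 0 < k ^ 2 := by positivity
  have hc2 : 1 < c ^ 2 := one_lt_pow₀ hc two_ne_zero
  have hPpos : 0 < c + 1 - 2 * a ^ 2 := by linarith
  have hPle : c + 1 - 2 * a ^ 2 ≤ 2 * c := by linarith [sq_nonneg a]
  have hDpos : 0 < (a * c - b) ^ 2 + (c ^ 2 - 1) * k ^ 2 := by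
    have : 0 < (c ^ 2 - 1) * k ^ 2 := mul_pos (by linarith) hk0
    positivity
  have hDle : (a * c - b) ^ 2 + (c ^ 2 - 1) * k ^ 2 ≤ 2 * c ^ 2 := by
    have h0 : a ≤ a * c := le_mul_of_one_le_right ha0.le hc.le
    have h1 : a * c ≤ c := mul_le_of_le_one_left hc0.le ha
    have h3 : (a * c - b) ^ 2 ≤ c ^ 2 := pow_le_pow_left₀ (by linarith) (by linarith) 2
    have h4 : (c ^ 2 - 1) * k ^ 2 ≤ c ^ 2 - 1 := mul_le_of_le_one_right (by linarith) hk2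
    linarith
  have hn : k ^ 2 * c ^ 2 * 2 ≤ 2 * (c * (c + 1) - a * (a + b)) := by
    have h5 : a * (a + b) ≤ a * (a + a) := mul_le_mul_of_nonneg_left (by linarith) ha0.le
    have h6 : k ^ 2 = 1 - a ^ 2 := by linarith
    have h7 : a ^ 2 ≤ a ^ 2 * c ^ 2 := le_mul_of_one_le_right (sq_nonneg a) hc2.le
    rw [h6]
    linarith
  rw [div_le_div_iff₀ (by positivity) (by positivity)]
  have hPD : (c + 1 - 2 * a ^ 2) * ((a * c - b) ^ 2 + (c ^ 2 - 1) * k ^ 2) ≤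
      2 * c * (2 * c ^ 2) := by gcongr
  calc k ^ 3 * (a - b) * ((c + 1 - 2 * a ^ 2) * ((a * c - b) ^ 2 + (c ^ 2 - 1) * k ^ 2))
      ≤ k ^ 3 * (a - b) * (2 * c * (2 * c ^ 2)) := by gcongr
    _ = k * (a - b) * (2 * c) * (k ^ 2 * c ^ 2 * 2) := by ring
    _ ≤ k * (a - b) * (2 * c) * (2 * (c * (c + 1) - a * (a + b))) := by gcongr
    _ = _ := by ring

/-- Where u has dropped to half its value at x, the gap of sines is at least U/10; the rest is
`gap_fraction_lower_bound` with 1/cosh y ≥ exp(-|y|). -/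
theorem gapKernel_lower_bound (hl : 0 < l) (hm : m < l) (hx : |u x| ≤ m) {η : ℝ}
    (h0 : 0 ≤ u (x - η)) (h : u (x - η) ≤ u x / 2) (hpos : 0 < u x) :
    Real.cos (waveNumber l * m) ^ 3 * (waveNumber l * u x) / 20 * Real.exp (-|waveNumber l * η|) ≤
      gapKernel l u x η := by
  have hμ := waveNumber_pos hl
  have hk0 := cos_waveNumber_mul_pos hl ((abs_nonneg _).trans hx) hm
  have hk := cos_waveNumber_mul_ge hl hm hx
  have hU := abs_le.1 (abs_waveNumber_mul_lt hl hm hx).le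
  have hUpos : 0 < waveNumber l * u x := mul_pos hμ hpos
  have hV0 : 0 ≤ waveNumber l * u (x - η) := mul_nonneg hμ.le h0
  have hV : waveNumber l * u (x - η) ≤ waveNumber l * u x / 2 := by
    rw [mul_div_assoc]; exact mul_le_mul_of_nonneg_left h hμ.le
  have hgap : waveNumber l * u x / 10 ≤
      Real.sin (waveNumber l * u x) - Real.sin (waveNumber l * u (x - η)) := by
    have h1 := sin_sub_sin_half_ge hUpos.le hU.2
    have h2 := Real.sin_le_sin_of_le_of_le_pi_div_two (x := waveNumber l * u (x - η))
      (by linarith [Real.pi_pos]) (by linarith) hV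
    linarith
  have hb0 : 0 ≤ Real.sin (waveNumber l * u (x - η)) :=
    Real.sin_nonneg_of_nonneg_of_le_pi hV0 (by linarith [Real.pi_pos])
  have ha1 := Real.sin_le_one (waveNumber l * u x)
  have hy : waveNumber l * η ≠ 0 := by
    intro hy
    have hη := (mul_eq_zero.1 hy).resolve_left hμ.ne'
    rw [hη, sub_zero] at h
    linarith
  have hP := sin_sq_denominator_ge (waveNumber l * u x) (waveNumber l * η)
  have hc1 := Real.one_lt_cosh.2 hy
  have hs := Real.cosh_sq (waveNumber l * η)
  have hcos := Real.sin_sq_add_cos_sq (waveNumber l * u x)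
  have hce : Real.exp (-|waveNumber l * η|) * Real.cosh (waveNumber l * η) ≤ 1 := by
    rw [← Real.cosh_abs, Real.cosh_eq]
    have h1 : Real.exp (-|waveNumber l * η|) * Real.exp |waveNumber l * η| = 1 := by
      rw [← Real.exp_add]; simp
    have h2 : Real.exp (-|waveNumber l * η|) ≤ 1 := Real.exp_le_one_iff.2 (neg_nonpos.2 (abs_nonneg _))
    have h3 := Real.exp_pos (-|waveNumber l * η|)
    nlinarith
  have hE := Real.exp_pos (-|waveNumber l * η|)
  have hmain : Real.cos (waveNumber l * u x) ^ 3 *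
      (Real.sin (waveNumber l * u x) - Real.sin (waveNumber l * u (x - η))) /
      (2 * Real.cosh (waveNumber l * η)) ≤ gapKernel l u x η := by
    unfold gapKernel
    have hkx := hk0.trans_le hk
    rw [mul_pow, show Real.sinh (waveNumber l * η) ^ 2 = Real.cosh (waveNumber l * η) ^ 2 - 1 by
      linarith]
    have : 0 < waveNumber l * u x / 10 := by positivity
    exact gap_fraction_lower_bound hkx hcos hb0 (by linarith) ha1 hc1
  refine le_trans ?_ hmain
  rw [le_div_iff₀ (by positivity)]
  calc _ = Real.cos (waveNumber l * m) ^ 3 * (waveNumber l * u x / 10) *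
        (Real.exp (-|waveNumber l * η|) * Real.cosh (waveNumber l * η)) := by ring
    _ ≤ Real.cos (waveNumber l * m) ^ 3 * (waveNumber l * u x / 10) * 1 := by gcongr
    _ ≤ _ := by
        rw [mul_one]
        have := hk0.trans_le hk
        gcongr

/-- At a maximum point the principal value is nonpositive. -/
theorem HasPrincipalValue.nonpos_of_forall_le (hl : 0 < l) (hm : m < l)
    (hu : RegularProfile m L u) (hmax : ∀ z, u z ≤ u x) {p : ℝ}
    (hp : HasPrincipalValue (muskatIntegrand l u x) p) : p ≤ 0 := by
  have h0 : deriv u x = 0 := IsLocalMax.deriv_eq_zero (Eventually.of_forall hmax)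
  rw [hp.eq_neg_integral_gapKernel hl hm hu h0, neg_nonpos]
  exact integral_nonneg fun η => gapKernel_nonneg hl hm hu (hmax _)

/-- The quantitative version of the sign of the principal value at the maximum point of a
nonnegative integrable profile. -/
theorem HasPrincipalValue.le_of_forall_le (hl : 0 < l) (hm : m < l)
    (hu : RegularProfile m L u) (hmax : ∀ z, u z ≤ u x) (hpos : 0 < u x) (hnn : ∀ z, 0 ≤ u z)
    (hint : Integrable u) {A m₀ : ℝ} (hA : 0 < A) (hle : ∫ z, u z ≤ A) (hm₀ : m₀ < l)
    (hx : u x ≤ m₀) {p : ℝ} (hp : HasPrincipalValue (muskatIntegrand l u x) p) :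
    p ≤ -(Real.cos (waveNumber l * m₀) ^ 3 * waveNumber l * A / 10 *
      Real.exp (-(Real.pi * A) / (l * u x))) := by
  have hμ := waveNumber_pos hl
  have h0 : deriv u x = 0 := IsLocalMax.deriv_eq_zero (Eventually.of_forall hmax)
  rw [hp.eq_neg_integral_gapKernel hl hm hu h0, neg_le_neg_iff]
  have hgi := integrable_gapKernel hl hm hu h0
  have hcont := hu.differentiable.continuous
  -- By Chebyshev `B` has measure at most R, so out of the length 2R of [-R, R] at least R is left
  -- for `S`.
  set R := 2 * A / u x with hR
  have hRpos : 0 < R := by positivity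
  set S := Icc (-R) R ∩ {η | u (x - η) ≤ u x / 2} with hS
  have hSm : MeasurableSet S := measurableSet_Icc.inter
    (measurableSet_le (hcont.measurable.comp (by fun_prop)) measurable_const)
  set B := {η | u x / 2 ≤ u (x - η)} with hB
  have hSfin : volume S ≠ ⊤ := measure_ne_top_of_subset inter_subset_left (by simp)
  have hint' : Integrable fun η => u (x - η) := hint.comp_sub_left x
  have hBfin : volume B ≠ ⊤ := (hint'.measure_ge_lt_top (by positivity)).ne
  have hBle : volume.real B ≤ R := by
    have := mul_meas_ge_le_integral_of_nonneg (ae_of_all _ fun η => hnn (x - η)) hint' (u x / 2)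
    rw [integral_sub_left_eq_self u volume x] at this
    rw [hR, le_div_iff₀ hpos]
    change u x / 2 * volume.real B ≤ _ at this
    linarith
  have hSge : R ≤ volume.real S := by
    have h1 : volume.real (Icc (-R) R) ≤ volume.real (S ∪ B) := by
      apply measureReal_mono _ (measure_union_lt_top hSfin.lt_top hBfin.lt_top).ne
      intro η hη
      rcases le_total (u (x - η)) (u x / 2) with h | h
      · exact Or.inl ⟨hη, h⟩
      · exact Or.inr h
    have h2 := measureReal_union_le (μ := volume) S B
    rw [Real.volume_real_Icc_of_le (by linarith)] at h1
    linarith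
  -- A lower bound of the kernel on `S`, where |η| ≤ R. It involves m₀, a bound at the maximum
  -- point, rather than the bound m of the regularity class; this lets the rate depend on the
  -- initial datum alone.
  set K := Real.cos (waveNumber l * m₀) ^ 3 * (waveNumber l * u x) / 20 *
    Real.exp (-(waveNumber l * R))
  have hk0 := cos_waveNumber_mul_pos hl (hpos.le.trans hx) hm₀
  have hK0 : 0 ≤ K := by positivity
  have hlow : ∀ η ∈ S, K ≤ gapKernel l u x η := by
    intro η hη
    refine le_trans ?_ (gapKernel_lower_bound hl hm₀ (by rwa [abs_of_pos hpos]) (hnn _) hη.2 hpos)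
    have : |waveNumber l * η| ≤ waveNumber l * R := by
      rw [abs_mul, abs_of_pos hμ]
      exact mul_le_mul_of_nonneg_left (abs_le.2 hη.1) hμ.le
    exact mul_le_mul_of_nonneg_left (Real.exp_le_exp.2 (neg_le_neg this)) (by positivity)
  calc _ = R * K := by
        have : -(Real.pi * A) / (l * u x) = -(waveNumber l * R) := by
          rw [hR, waveNumber]; field_simp
        rw [this, hR]
        field_simp
        simp only [K, hR]
        field_simp
        norm_num
    _ ≤ volume.real S * K := by gcongr
    _ = ∫ η in S, K := by rw [setIntegral_const, smul_eq_mul]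
    _ ≤ ∫ η in S, gapKernel l u x η :=
        setIntegral_mono_on (integrableOn_const hSfin) hgi.integrableOn hSm hlow
    _ ≤ ∫ η, gapKernel l u x η :=
        setIntegral_le_integral hgi (ae_of_all _ fun η => gapKernel_nonneg hl hm hu (hmax _))

/-- Both kernels depend on the profile through even cosines, so the operator is odd: upper bounds
become lower bounds and nonpositive profiles become nonnegative ones. -/
theorem muskatIntegrand_neg (l : ℝ) (u : ℝ → ℝ) (x : ℝ) :
    muskatIntegrand l (-u) x = -muskatIntegrand l u x := by
  funext η
  have h1 : Xi1 l (-u) x η = Xi1 l u x η := by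
    simp only [Xi1, Pi.neg_apply]
    rw [← Real.cos_neg]
    congr 3
    ring
  have h2 : Xi2 l (-u) x η = Xi2 l u x η := by
    simp only [Xi2, Pi.neg_apply]
    rw [← Real.cos_neg]
    congr 3
    ring
  simp only [muskatIntegrand, h1, h2, deriv.neg', Pi.neg_apply]
  ring

theorem HasPrincipalValue.neg {h : ℝ → ℝ} {a : ℝ} (hp : HasPrincipalValue h a) :
    HasPrincipalValue (-h) (-a) where
  integrableOn ε R hε := (hp.integrableOn ε R hε).neg
  tendsto := by
    simp only [Pi.neg_apply, integral_neg]
    exact hp.tendsto.neg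

theorem HasMuskatRHS.neg {ρ1 ρ2 l : ℝ} {u : ℝ → ℝ} {x a : ℝ} (h : HasMuskatRHS ρ1 ρ2 l u x a) :
    HasMuskatRHS ρ1 ρ2 l (-u) x (-a) := by
  obtain ⟨p, hp, rfl⟩ := h
  refine ⟨-p, ?_, by ring⟩
  rw [muskatIntegrand_neg]
  exact hp.neg

theorem RegularProfile.neg (hu : RegularProfile m L u) : RegularProfile m L (-u) where
  differentiable := hu.differentiable.neg
  bound x := by simpa using hu.bound x
  deriv_bound x := by simpa [deriv.neg'] using hu.deriv_bound x
  deriv_lipschitz x y := by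
    simp only [deriv.neg', neg_sub_neg]
    rw [abs_sub_comm]
    exact hu.deriv_lipschitz x y
  tendsto_zero := by
    have := hu.tendsto_zero.neg
    rwa [neg_zero] at this

theorem RegularProfile.exists_forall_le (hu : RegularProfile m L u) {z : ℝ} (hz : 0 < u z) :
    ∃ x, ∀ y, u y ≤ u x := by
  apply hu.differentiable.continuous.exists_forall_ge' z
  filter_upwards [hu.tendsto_zero.eventually (Iio_mem_nhds hz)] with y hy
  exact le_of_lt hy

end

/-! ### Conservation form and decay of the flux -/

/-- The flux through `x` of the internal wave equation, up to a factor. -/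
noncomputable def flux (l : ℝ) (u : ℝ → ℝ) (x : ℝ) : ℝ :=
  ∫ η, (phase l u x η - waveNumber l * u x *
    (Real.sinh (waveNumber l * η) / Real.cosh (waveNumber l * η)))

section

variable {l m L : ℝ} {u : ℝ → ℝ} {x : ℝ}

theorem measurable_phase_sub (hu : Measurable u) :
    Measurable fun p : ℝ × ℝ => phase l u p.1 p.2 - waveNumber l * u p.1 *
      (Real.sinh (waveNumber l * p.2) / Real.cosh (waveNumber l * p.2)) := by
  unfold phase
  have := Real.continuous_arctan.measurable
  fun_prop

theorem hasDerivAt_phase_sub_space (hl : 0 < l) (hm : m < l) (hu : RegularProfile m L u) {η : ℝ}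
    (hη : η ≠ 0) (x : ℝ) :
    HasDerivAt (fun z => phase l u z η - waveNumber l * u z *
      (Real.sinh (waveNumber l * η) / Real.cosh (waveNumber l * η)))
      (waveNumber l / 2 * reducedIntegrand l u x η) x := by
  have hc : 0 < Real.cos (waveNumber l * u x) :=
    (cos_waveNumber_mul_pos hl hu.bound_nonneg hm).trans_le
      (cos_waveNumber_mul_ge hl hm (hu.bound x))
  convert! (hasDerivAt_phase_space hl hu.differentiable hc.ne' hη).sub
    (((hu.differentiable x).hasDerivAt.const_mul (waveNumber l)).mul_const
      (Real.sinh (waveNumber l * η) / Real.cosh (waveNumber l * η))) using 1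
  unfold reducedIntegrand
  ring

/-- The exponential envelopes justify Fubini, and for each fixed η ≠ 0 one integrates by parts in x.
-/
theorem integral_mul_reducedIntegrand_eq (hl : 0 < l) (hm : m < l) (hu : RegularProfile m L u)
    {ψ : ℝ → ℝ} (hψ : ContDiff ℝ 1 ψ) (hc : HasCompactSupport ψ) :
    ∫ x, ψ x * ∫ η, reducedIntegrand l u x η =
      -(2 / waveNumber l) * ∫ x, deriv ψ x * flux l u x := by
  have hμ := waveNumber_pos hl
  have hucont := hu.differentiable.continuous
  have hψi : Integrable ψ := hψ.continuous.integrable_of_hasCompactSupport hc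
  have hψ'c : Continuous (deriv ψ) := hψ.continuous_deriv le_rfl
  have hψ'i : Integrable (deriv ψ) := hψ'c.integrable_of_hasCompactSupport hc.deriv
  have hexp := integrable_exp_neg_mul_abs hμ
  have key : ∀ (χ : ℝ → ℝ) (F : ℝ → ℝ → ℝ) (K : ℝ), Integrable χ → Measurable χ →
      Measurable (fun p : ℝ × ℝ => F p.1 p.2) →
      (∀ x η, |F x η| ≤ K * Real.exp (-|waveNumber l * η|)) →
      Integrable (Function.uncurry fun x η => χ x * F x η) (volume.prod volume) := by
    intro χ F K hχ hχm hF hFK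
    refine (hχ.abs.mul_prod (hexp.const_mul K)).mono' ?_ (ae_of_all _ fun p => ?_)
    · exact ((hχm.comp measurable_fst).mul hF).aestronglyMeasurable
    · simp only [Function.uncurry, norm_mul, Real.norm_eq_abs]
      gcongr
      exact hFK _ _
  have hi1 := key ψ (reducedIntegrand l u) _ hψi hψ.continuous.measurable
    (measurable_reducedIntegrand hu) (abs_reducedIntegrand_le hl hm hu)
  have hi2 := key (deriv ψ) (fun x η => phase l u x η - waveNumber l * u x *
    (Real.sinh (waveNumber l * η) / Real.cosh (waveNumber l * η))) _ hψ'i hψ'c.measurable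
    (measurable_phase_sub hucont.measurable) (fun x η => abs_phase_sub_le hl hm (hu.bound x) η)
  unfold flux
  have eA : ∀ x, ψ x * ∫ η, reducedIntegrand l u x η = ∫ η, ψ x * reducedIntegrand l u x η :=
    fun x => (integral_const_mul _ _).symm
  have eB : ∀ x, deriv ψ x * ∫ η, (phase l u x η - waveNumber l * u x *
      (Real.sinh (waveNumber l * η) / Real.cosh (waveNumber l * η))) =
      ∫ η, deriv ψ x * (phase l u x η - waveNumber l * u x *
      (Real.sinh (waveNumber l * η) / Real.cosh (waveNumber l * η))) :=
    fun x => (integral_const_mul _ _).symm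
  simp_rw [eA, eB]
  rw [integral_integral_swap hi1, integral_integral_swap hi2, ← integral_const_mul]
  apply integral_congr_ae
  have h0 : ∀ᵐ η : ℝ, η ≠ 0 := by simp [ae_iff]
  filter_upwards [h0] with η hη
  have hd := hasDerivAt_phase_sub_space hl hm hu hη
  have hcontP : Continuous fun z => phase l u z η - waveNumber l * u z *
      (Real.sinh (waveNumber l * η) / Real.cosh (waveNumber l * η)) :=
    continuous_iff_continuousAt.2 fun z => (hd z).continuousAt
  have hbdd : ∀ z, ‖phase l u z η - waveNumber l * u z *
      (Real.sinh (waveNumber l * η) / Real.cosh (waveNumber l * η))‖ ≤ _ := fun z =>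
    abs_phase_sub_le hl hm (hu.bound z) η
  have hbdd' : ∀ z, ‖waveNumber l / 2 * reducedIntegrand l u z η‖ ≤ waveNumber l / 2 *
      (kernelBound l m L * Real.exp (-|waveNumber l * η|)) := fun z => by
    rw [norm_mul, Real.norm_of_nonneg (by positivity)]
    exact mul_le_mul_of_nonneg_left (abs_reducedIntegrand_le hl hm hu z η) (by positivity)
  have hmeas : AEStronglyMeasurable (fun z => waveNumber l / 2 * reducedIntegrand l u z η) :=
    (((measurable_reducedIntegrand hu).comp measurable_prodMk_right).const_mul
      _).aestronglyMeasurable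
  have := integral_mul_deriv_eq_deriv_mul_of_integrable (u := ψ) (u' := deriv ψ)
    (fun x _ => (hψ.differentiable one_ne_zero x).hasDerivAt) (fun x _ => hd x)
    (hψi.mul_bdd hmeas (ae_of_all _ hbdd'))
    (hψ'i.mul_bdd hcontP.aestronglyMeasurable (ae_of_all _ hbdd))
    (hψi.mul_bdd hcontP.aestronglyMeasurable (ae_of_all _ hbdd))
  have e : ∀ z, ψ z * reducedIntegrand l u z η =
      2 / waveNumber l * (ψ z * (waveNumber l / 2 * reducedIntegrand l u z η)) := fun z => by
    field_simp
  simp_rw [e]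
  rw [integral_const_mul, this]
  ring

end

/-- For fixed η ≠ 0 both u(x) and u(x-η) tend to 0, hence so does the corrected phase; its
exponential envelope is uniform in time and position, so dominated convergence applies. -/
theorem tendsto_flux_zero {l m L : ℝ} (hl : 0 < l) (hm : m < l) {f : ℝ → ℝ → ℝ} {S : Set ℝ}
    (hf : ∀ t ∈ S, RegularProfile m L (f t))
    (hdec : Tendsto (fun q : ℝ × ℝ => f q.1 q.2) (𝓟 S ×ˢ cocompact ℝ) (𝓝 0)) :
    Tendsto (fun q : ℝ × ℝ => flux l (f q.1) q.2) (𝓟 S ×ˢ cocompact ℝ) (𝓝 0) := by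
  have hμ := waveNumber_pos hl
  have hmem : ∀ᶠ q : ℝ × ℝ in 𝓟 S ×ˢ cocompact ℝ, q.1 ∈ S :=
    (eventually_principal.2 fun t ht => ht : ∀ᶠ t in 𝓟 S, t ∈ S).prod_inl _
  have hcg : (cocompact ℝ).IsCountablyGenerated := by
    rw [cocompact_eq_atBot_atTop]; infer_instance
  rw [show (0 : ℝ) = ∫ _ : ℝ, (0 : ℝ) by simp]
  refine tendsto_integral_filter_of_dominated_convergence _ ?_ ?_
    ((integrable_exp_neg_mul_abs hμ).const_mul (3 * (4 + 8 / Real.cos (waveNumber l * m)))) ?_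
  · filter_upwards [hmem] with q hq
    exact ((measurable_phase_sub (hf _ hq).differentiable.continuous.measurable).comp
      measurable_prodMk_left).aestronglyMeasurable
  · filter_upwards [hmem] with q hq
    exact ae_of_all _ fun η => abs_phase_sub_le hl hm ((hf _ hq).bound _) η
  · have h0 : ∀ᵐ η : ℝ, η ≠ 0 := by simp [ae_iff]
    filter_upwards [h0] with η hη
    have hshift : Tendsto (fun q : ℝ × ℝ => f q.1 (q.2 - η)) (𝓟 S ×ˢ cocompact ℝ) (𝓝 0) := by
      have : Tendsto (fun q : ℝ × ℝ => (q.1, q.2 - η)) (𝓟 S ×ˢ cocompact ℝ)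
          (𝓟 S ×ˢ cocompact ℝ) :=
        tendsto_id.prodMap ((Homeomorph.subRight η).isClosedEmbedding.tendsto_cocompact)
      exact hdec.comp this
    have hU := hdec.const_mul (waveNumber l)
    have hV := hshift.const_mul (waveNumber l)
    rw [mul_zero] at hU hV
    have hsU := (Real.continuous_sin.tendsto 0).comp hU
    have hcU := (Real.continuous_cos.tendsto 0).comp hU
    have hsV := (Real.continuous_sin.tendsto 0).comp hV
    have hq := ((hsU.mul_const (Real.cosh (waveNumber l * η))).sub hsV).div
      (hcU.const_mul (Real.sinh (waveNumber l * η)))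
      (by simpa using ⟨hμ.ne', hη⟩)
    have ha := (Real.continuous_arctan.tendsto _).comp hq
    have := ha.sub (hU.mul_const (Real.sinh (waveNumber l * η) / Real.cosh (waveNumber l * η)))
    simpa [phase, Function.comp_def] using this

/-! ### Wide cutoffs -/

/-- A smooth cutoff equal to `1` on `[-1, 1]` and vanishing outside `[-2, 2]`. -/
noncomputable def cutoff : ContDiffBump (0 : ℝ) := ⟨1, 2, one_pos, one_lt_two⟩

theorem cutoff_eq_one {x : ℝ} (hx : |x| ≤ 1) : cutoff x = 1 :=
  cutoff.one_of_mem_closedBall (by simpa [Metric.mem_closedBall, cutoff] using hx)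

theorem contDiff_cutoff_div (R : ℝ) : ContDiff ℝ 1 fun x => cutoff (x / R) :=
  cutoff.contDiff.comp (contDiff_id.div_const R)

theorem hasCompactSupport_cutoff_div {R : ℝ} (hR : 0 < R) :
    HasCompactSupport fun x => cutoff (x / R) := by
  have := cutoff.hasCompactSupport.comp_homeomorph (Homeomorph.mulRight₀ R⁻¹ (inv_ne_zero hR.ne'))
  simpa [Function.comp_def, div_eq_mul_inv] using this

theorem deriv_cutoff_div (R x : ℝ) :
    deriv (fun x => cutoff (x / R)) x = deriv cutoff (x / R) / R := by
  have h : HasDerivAt cutoff (deriv cutoff (x / R)) (x / R) :=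
    ((cutoff.contDiff (n := 1)).differentiable one_ne_zero _).hasDerivAt
  have := h.comp x ((hasDerivAt_id x).div_const R)
  rw [mul_one_div] at this
  exact this.deriv

theorem deriv_cutoff_div_eq_zero {R x : ℝ} (hR : 0 < R) (hx : |x| < R) :
    deriv (fun x => cutoff (x / R)) x = 0 := by
  have : (fun x => cutoff (x / R)) =ᶠ[𝓝 x] fun _ => 1 := by
    filter_upwards [(isOpen_lt continuous_abs continuous_const).mem_nhds hx] with y hy
    apply cutoff_eq_one
    rw [abs_div, abs_of_pos hR, div_le_one hR]
    exact le_of_lt hy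
  rw [this.deriv_eq, deriv_const]

/-- This scale invariance lets a flux that merely tends to 0, without any rate, suffice for mass
conservation. -/
theorem integral_abs_deriv_cutoff_div {R : ℝ} (hR : 0 < R) :
    ∫ x, |deriv (fun x => cutoff (x / R)) x| = ∫ x, |deriv cutoff x| := by
  rw [funext fun x => congrArg abs (deriv_cutoff_div R x)]
  simp only [abs_div, abs_of_pos hR]
  rw [integral_div, Measure.integral_comp_div (fun x => |deriv cutoff x|), abs_of_pos hR,
    smul_eq_mul, mul_div_cancel_left₀ _ hR.ne']

theorem integrable_and_integral_le_of_cutoff {g : ℝ → ℝ} (hg : Continuous g) (hnn : ∀ x, 0 ≤ g x)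
    {A : ℝ} (h : ∀ ε > 0, ∀ᶠ R in atTop, ∫ x, g x * cutoff (x / R) ≤ A + ε) :
    Integrable g ∧ ∫ x, g x ≤ A := by
  have hle : ∀ ε > 0, ∀ᶠ R : ℝ in atTop, ∫ x in (-R)..R, g x ≤ A + ε := by
    intro ε hε
    filter_upwards [h ε hε, eventually_gt_atTop 0] with R hR hR0
    refine le_trans ?_ hR
    have hc := hasCompactSupport_cutoff_div hR0
    have hi : Integrable fun x => g x * cutoff (x / R) :=
      (hg.mul (contDiff_cutoff_div R).continuous).integrable_of_hasCompactSupport hc.mul_left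
    rw [intervalIntegral.integral_of_le (by linarith)]
    calc ∫ x in Ioc (-R) R, g x = ∫ x in Ioc (-R) R, g x * cutoff (x / R) := by
          refine setIntegral_congr_fun measurableSet_Ioc fun x hx => ?_
          rw [cutoff_eq_one, mul_one]
          rw [abs_div, abs_of_pos hR0, div_le_one hR0]
          exact abs_le.2 ⟨hx.1.le, hx.2⟩
      _ ≤ _ := setIntegral_le_integral hi
          (ae_of_all _ fun x => mul_nonneg (hnn x) cutoff.nonneg)
  have hint : Integrable g := by
    refine integrable_of_intervalIntegral_norm_bounded (a := fun R : ℝ => -R) (b := fun R => R)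
      (l := atTop) (A + 1) (fun R => hg.integrableOn_Ioc) tendsto_neg_atTop_atBot tendsto_id ?_
    filter_upwards [hle 1 one_pos] with R hR
    simpa only [Real.norm_of_nonneg (hnn _)] using hR
  refine ⟨hint, le_of_forall_pos_le_add fun ε hε => ?_⟩
  exact le_of_tendsto (intervalIntegral_tendsto_integral hint tendsto_neg_atTop_atBot tendsto_id)
    (hle ε hε)

/-! ### From Sobolev solutions to uniformly regular solutions -/

section

variable {l m L m' L' : ℝ} {u v : ℝ → ℝ}

theorem RegularProfile.mono (hu : RegularProfile m L u) (hm : m ≤ m') (hL : L ≤ L') :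
    RegularProfile m' L' u where
  differentiable := hu.differentiable
  bound x := (hu.bound x).trans hm
  deriv_bound x := (hu.deriv_bound x).trans hL
  deriv_lipschitz x y :=
    (hu.deriv_lipschitz x y).trans (mul_le_mul_of_nonneg_right hL (abs_nonneg _))
  tendsto_zero := hu.tendsto_zero

theorem RegularProfile.add (hu : RegularProfile m L u) (hv : RegularProfile m' L' v) :
    RegularProfile (m + m') (L + L') (u + v) := by
  have hd : ∀ x, deriv (u + v) x = deriv u x + deriv v x := fun x =>
    deriv_add (hu.differentiable x) (hv.differentiable x)
  refine ⟨hu.differentiable.add hv.differentiable, fun x => ?_, fun x => ?_, fun x y => ?_, ?_⟩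
  · exact (abs_add_le _ _).trans (add_le_add (hu.bound x) (hv.bound x))
  · rw [hd]
    exact (abs_add_le _ _).trans (add_le_add (hu.deriv_bound x) (hv.deriv_bound x))
  · rw [hd, hd, add_sub_add_comm, add_mul]
    exact (abs_add_le _ _).trans (add_le_add (hu.deriv_lipschitz x y) (hv.deriv_lipschitz x y))
  · have := hu.tendsto_zero.add hv.tendsto_zero
    rwa [add_zero] at this

theorem regularProfile_of_sobolevENorm_lt {k : ℕ} (hk : 3 ≤ k) (hu : Continuous u) {E : ℝ}
    (h : sobolevENorm k u < ENNReal.ofReal E) : RegularProfile (2 * E) (2 * E) u := by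
  obtain ⟨h1, h2, h3, h4, h5⟩ := sobolev_bounds hk hu h
  exact ⟨h1, h2, h3, h4, h5⟩

theorem Continuous.abs_le_lpNorm_top (hu : Continuous u) (hb : eLpNorm u ∞ volume < ⊤) (x : ℝ) :
    |u x| ≤ lpNorm u ∞ volume := by
  have h := ae_le_lpNorm_exponent_top (μ := volume) ⟨hu.aestronglyMeasurable, hb⟩
  have hd := Measure.dense_of_ae h
  have hcl : IsClosed {x | ‖u x‖ ≤ lpNorm u ∞ volume} := isClosed_le hu.norm continuous_const
  have := hcl.closure_eq ▸ hd.closure_eq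
  exact (this ▸ mem_univ x : x ∈ {x | ‖u x‖ ≤ lpNorm u ∞ volume})

theorem Continuous.lpNorm_top_le (hu : Continuous u) {c : ℝ} (hc : 0 ≤ c) (h : ∀ x, |u x| ≤ c) :
    lpNorm u ∞ volume ≤ c := by
  rw [← toReal_eLpNorm hu.aestronglyMeasurable]
  apply ENNReal.toReal_le_of_le_ofReal hc
  rw [eLpNorm_exponent_top]
  exact eLpNormEssSup_le_of_ae_bound (ae_of_all _ h)

theorem MemHkl.lpNorm_lt {k : ℕ} (hl : 0 < l) (hu : MemHkl k l u) : lpNorm u ∞ volume < l := by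
  rw [← toReal_eLpNorm hu.continuous.aestronglyMeasurable]
  have := (ENNReal.toReal_lt_toReal (hu.bounded.trans ENNReal.ofReal_lt_top).ne
    ENNReal.ofReal_ne_top).2 hu.bounded
  rwa [ENNReal.toReal_ofReal hl.le] at this

theorem MemHkl.abs_le_lpNorm {k : ℕ} (hu : MemHkl k l u) (x : ℝ) : |u x| ≤ lpNorm u ∞ volume :=
  hu.continuous.abs_le_lpNorm_top (hu.bounded.trans ENNReal.ofReal_lt_top) x

theorem MemHkl.exists_regularProfile {k : ℕ} (hk : 3 ≤ k) (hu : MemHkl k l u) :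
    ∃ L, RegularProfile (lpNorm u ∞ volume) L u := by
  have hlt : sobolevENorm k u < ENNReal.ofReal ((sobolevENorm k u).toReal + 1) := by
    rw [ENNReal.lt_ofReal_iff_toReal_lt hu.sobolev.ne]
    linarith
  have := regularProfile_of_sobolevENorm_lt hk hu.continuous hlt
  exact ⟨_, { this with bound := hu.abs_le_lpNorm }⟩

end

/-- A solution of `∂ₜ f = C · P.V. ∫ …` on `[0, T]` with uniformly regular time slices which vanish
at infinity uniformly in time. -/
structure RegularSolution (C l m L T : ℝ) (f : ℝ → ℝ → ℝ) : Prop where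
  const_pos : 0 < C
  width_pos : 0 < l
  bound_lt : m < l
  regular : ∀ t ∈ Icc 0 T, RegularProfile m L (f t)
  continuous_time : ∀ x, ContinuousOn (fun t => f t x) (Icc 0 T)
  tendsto_zero : Tendsto (fun q : ℝ × ℝ => f q.1 q.2) (𝓟 (Icc 0 T) ×ˢ cocompact ℝ) (𝓝 0)
  equation : ∀ t ∈ Ioo 0 T, ∀ x, ∃ p, HasPrincipalValue (muskatIntegrand l (f t) x) p ∧
    HasDerivAt (fun s => f s x) (C * p) t

section

variable {ρ1 ρ2 l T : ℝ} {k : ℕ} {f₀ : ℝ → ℝ} {f : ℝ → ℝ → ℝ}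

theorem IsClassicalSolution.eventually_regularProfile_sub (hk : 3 ≤ k)
    (hf : IsClassicalSolution ρ1 ρ2 l k T f₀ f) {t : ℝ} (ht : t ∈ Icc 0 T) {ε : ℝ} (hε : 0 < ε) :
    ∀ᶠ s in 𝓝[Icc 0 T] t, RegularProfile ε ε (fun x => f s x - f t x) := by
  have h := (hf.continuous_time t ht).eventually
    (Iio_mem_nhds (ENNReal.ofReal_pos.2 (half_pos hε)))
  filter_upwards [h, self_mem_nhdsWithin] with s hs hsT
  have := regularProfile_of_sobolevENorm_lt hk
    ((hf.mem s hsT).continuous.sub (hf.mem t ht).continuous) hs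
  rwa [mul_div_cancel₀ ε two_ne_zero] at this

/-- Near each time the solution differs from its slice by a small regular profile; compactness of
[0, T] makes the constants uniform and keeps m strictly below l. -/
theorem IsClassicalSolution.exists_uniform_regularProfile (hl : 0 < l) (hk : 3 ≤ k)
    (hf : IsClassicalSolution ρ1 ρ2 l k T f₀ f) :
    ∃ m < l, ∃ L, ∀ t ∈ Icc 0 T, RegularProfile m L (f t) := by
  have key : ∃ m < l, ∃ L, ∀ t ∈ Icc 0 T, t ∈ Icc 0 T → RegularProfile m L (f t) := by
    refine (isCompact_Icc (a := (0 : ℝ)) (b := T)).induction_on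
      (p := fun A => ∃ m < l, ∃ L, ∀ t ∈ A, t ∈ Icc 0 T → RegularProfile m L (f t)) ?_ ?_ ?_ ?_
    · exact ⟨0, hl, 0, fun t ht => ht.elim⟩
    · rintro A B hAB ⟨m, hm, L, h⟩
      exact ⟨m, hm, L, fun t ht => h t (hAB ht)⟩
    · rintro A B ⟨m, hm, L, h⟩ ⟨m', hm', L', h'⟩
      refine ⟨max m m', max_lt hm hm', max L L', fun t ht htT => ?_⟩
      rcases ht with ht | ht
      · exact (h t ht htT).mono (le_max_left _ _) (le_max_left _ _)
      · exact (h' t ht htT).mono (le_max_right _ _) (le_max_right _ _)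
    · intro t ht
      obtain ⟨L, hL⟩ := (hf.mem t ht).exists_regularProfile hk
      have hlt := (hf.mem t ht).lpNorm_lt hl
      set M := lpNorm (f t) ∞ volume
      -- Half of the room between the slice and the wall is spent on nearby times.
      have hε : 0 < (l - M) / 2 := by linarith
      refine ⟨_, hf.eventually_regularProfile_sub hk ht hε, M + (l - M) / 2, by linarith,
        L + (l - M) / 2, fun s hs _ => ?_⟩
      have := hL.add hs
      convert! this using 1
      funext x
      simp
  obtain ⟨m, hm, L, h⟩ := key
  exact ⟨m, hm, L, fun t ht => h t ht ht⟩

theorem IsClassicalSolution.tendsto_zero (hk : 3 ≤ k)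
    (hf : IsClassicalSolution ρ1 ρ2 l k T f₀ f) :
    Tendsto (fun q : ℝ × ℝ => f q.1 q.2) (𝓟 (Icc 0 T) ×ˢ cocompact ℝ) (𝓝 0) := by
  rw [Metric.tendsto_nhds]
  intro ε hε
  have key : ∀ᶠ x in cocompact ℝ, ∀ t ∈ Icc 0 T, t ∈ Icc 0 T → |f t x| < ε := by
    refine (isCompact_Icc (a := (0 : ℝ)) (b := T)).induction_on
      (p := fun A => ∀ᶠ x in cocompact ℝ, ∀ t ∈ A, t ∈ Icc 0 T → |f t x| < ε) ?_ ?_ ?_ ?_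
    · simp
    · intro A B hAB h
      filter_upwards [h] with x hx t ht using hx t (hAB ht)
    · intro A B h h'
      filter_upwards [h, h'] with x hx hx' t ht using ht.elim (hx t) (hx' t)
    · intro t ht
      obtain ⟨L, hL⟩ := (hf.mem t ht).exists_regularProfile hk
      refine ⟨_, hf.eventually_regularProfile_sub hk ht (half_pos hε), ?_⟩
      have h0 := (Metric.tendsto_nhds.1 hL.tendsto_zero) (ε / 2) (half_pos hε)
      filter_upwards [h0] with x hx s hs _
      rw [Real.dist_eq, sub_zero] at hx
      have h1 := hs.bound x
      have h2 := abs_add_le (f s x - f t x) (f t x)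
      rw [sub_add_cancel] at h2
      linarith
  have h1 : ∀ᶠ t in 𝓟 (Icc 0 T), t ∈ Icc 0 T := eventually_principal.2 fun t ht => ht
  filter_upwards [h1.prod_inl (cocompact ℝ), key.prod_inr (𝓟 (Icc 0 T))] with q hq hq'
  rw [Real.dist_eq, sub_zero]
  exact hq' q.1 hq hq

theorem IsClassicalSolution.exists_regularSolution (hρ : ρ1 < ρ2) (hl : 0 < l) (hk : 3 ≤ k)
    (hf : IsClassicalSolution ρ1 ρ2 l k T f₀ f) :
    ∃ m L, RegularSolution ((ρ2 - ρ1) / (8 * l)) l m L T f := by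
  obtain ⟨m, hm, L, hreg⟩ := hf.exists_uniform_regularProfile hl hk
  refine ⟨m, L, div_pos (sub_pos.2 hρ) (by positivity), hl, hm, hreg, fun x t ht => ?_,
    hf.tendsto_zero hk, fun t ht x => ?_⟩
  · rw [ContinuousWithinAt, Metric.tendsto_nhds]
    intro ε hε
    filter_upwards [hf.eventually_regularProfile_sub hk ht (half_pos hε)] with s hs
    rw [Real.dist_eq]
    exact (hs.bound x).trans_lt (half_lt_self hε)
  · obtain ⟨a, ⟨p, hp, rfl⟩, hd⟩ := hf.equation t ht x
    exact ⟨p, hp, hd⟩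

end

/-! ### Lipschitz dependence on time and the maximum principle -/

namespace RegularSolution

variable {C l m L T : ℝ} {f : ℝ → ℝ → ℝ}

theorem neg (hf : RegularSolution C l m L T f) : RegularSolution C l m L T (-f) where
  const_pos := hf.const_pos
  width_pos := hf.width_pos
  bound_lt := hf.bound_lt
  regular t ht := (hf.regular t ht).neg
  continuous_time x := (hf.continuous_time x).neg
  tendsto_zero := by
    have := hf.tendsto_zero.neg
    rwa [neg_zero] at this
  equation t ht x := by
    obtain ⟨p, hp, hd⟩ := hf.equation t ht x
    refine ⟨-p, ?_, ?_⟩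
    · rw [Pi.neg_apply, muskatIntegrand_neg]
      exact hp.neg
    · rw [mul_neg]
      exact hd.neg

theorem hasDerivAt (hf : RegularSolution C l m L T f) {t : ℝ} (ht : t ∈ Ioo 0 T) (x : ℝ) :
    HasDerivAt (fun s => f s x) (C * ∫ η, reducedIntegrand l (f t) x η) t := by
  obtain ⟨p, hp, hd⟩ := hf.equation t ht x
  rwa [hp.eq_integral_reducedIntegrand hf.width_pos hf.bound_lt
    (hf.regular t (Ioo_subset_Icc_self ht))] at hd

theorem exists_abs_deriv_le (hf : RegularSolution C l m L T f) :
    ∃ K, 0 ≤ K ∧ ∀ t ∈ Ioo 0 T, ∀ x, |C * ∫ η, reducedIntegrand l (f t) x η| ≤ K := by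
  have hI : 0 ≤ ∫ η, Real.exp (-|waveNumber l * η|) := integral_nonneg fun η => (Real.exp_pos _).le
  have h : ∀ t ∈ Ioo 0 T, ∀ x, |C * ∫ η, reducedIntegrand l (f t) x η| ≤
      C * (|kernelBound l m L| * ∫ η, Real.exp (-|waveNumber l * η|)) := by
    intro t ht x
    have hreg := hf.regular t (Ioo_subset_Icc_self ht)
    rw [abs_mul, abs_of_pos hf.const_pos]
    apply mul_le_mul_of_nonneg_left _ hf.const_pos.le
    rw [← integral_const_mul]
    refine norm_integral_le_of_norm_le (f := fun η => reducedIntegrand l (f t) x η)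
      ((integrable_exp_neg_mul_abs (waveNumber_pos hf.width_pos)).const_mul _)
      (ae_of_all _ fun η => ?_)
    refine (abs_reducedIntegrand_le hf.width_pos hf.bound_lt hreg x η).trans ?_
    exact mul_le_mul_of_nonneg_right (le_abs_self _) (Real.exp_pos _).le
  exact ⟨_, mul_nonneg hf.const_pos.le (mul_nonneg (abs_nonneg _) hI), h⟩

theorem exists_lipschitz (hf : RegularSolution C l m L T f) :
    ∃ K, 0 ≤ K ∧ ∀ s ∈ Icc 0 T, ∀ t ∈ Icc 0 T, ∀ x, |f s x - f t x| ≤ K * |s - t| := by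
  obtain ⟨K, hK0, hK⟩ := hf.exists_abs_deriv_le
  have key : ∀ s ∈ Icc 0 T, ∀ t ∈ Icc 0 T, s < t → ∀ x, |f s x - f t x| ≤ K * |s - t| := by
    intro s hs t ht hst x
    obtain ⟨r, hr, hr'⟩ := exists_hasDerivAt_eq_slope (fun t => f t x) _ hst
      ((hf.continuous_time x).mono (Icc_subset_Icc hs.1 ht.2))
      (fun r hr => hf.hasDerivAt ⟨hs.1.trans_lt hr.1, hr.2.trans_le ht.2⟩ x)
    have h := hK r ⟨hs.1.trans_lt hr.1, hr.2.trans_le ht.2⟩ x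
    rw [hr', abs_div, div_le_iff₀ (abs_pos.2 (sub_ne_zero.2 hst.ne'))] at h
    rwa [abs_sub_comm, abs_sub_comm s]
  refine ⟨K, hK0, fun s hs t ht x => ?_⟩
  rcases lt_trichotomy s t with h | rfl | h
  · exact key s hs t ht h x
  · simp
  · rw [abs_sub_comm, abs_sub_comm s]
    exact key t ht s hs h x

/-- The maximum principle. -/
theorem le_of_initial_le (hf : RegularSolution C l m L T f) {c : ℝ} (hc : 0 ≤ c)
    (h0 : ∀ x, f 0 x ≤ c) {t : ℝ} (ht : t ∈ Icc 0 T) (x : ℝ) : f t x ≤ c := by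
  obtain ⟨K, hK0, hK⟩ := hf.exists_lipschitz
  have hbdd : ∀ t ∈ Icc 0 T, BddAbove (range (f t)) := fun t ht =>
    ⟨m, by rintro _ ⟨x, rfl⟩; exact (abs_le.1 ((hf.regular t ht).bound x)).2⟩
  -- Truncating at c ≥ 0 leaves only times with a positive supremum to study, and there it is
  -- attained because the slice vanishes at infinity.
  set P : ℝ → ℝ := fun t => max c (⨆ x, f t x) with hP
  have hfP : ∀ t ∈ Icc 0 T, ∀ x, f t x ≤ P t := fun t ht x =>
    (le_ciSup (hbdd t ht) x).trans (le_max_right _ _)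
  have hPle : ∀ t b, c ≤ b → (∀ x, f t x ≤ b) → P t ≤ b := fun t b hb h =>
    max_le hb (ciSup_le h)
  have hPlip : ∀ s ∈ Icc 0 T, ∀ t ∈ Icc 0 T, P s ≤ P t + K * |s - t| := by
    intro s hs t ht
    have hK' : 0 ≤ K * |s - t| := by positivity
    refine hPle _ _ ((le_max_left _ _).trans (le_add_of_nonneg_right hK')) fun x => ?_
    have h1 := (abs_le.1 (hK s hs t ht x)).2
    have h2 := hfP t ht x
    linarith
  have hPcont : ContinuousOn P (Icc 0 T) := by
    refine (LipschitzOnWith.of_dist_le_mul (K := K.toNNReal) fun s hs t ht => ?_).continuousOn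
    rw [Real.dist_eq, Real.dist_eq, Real.coe_toNNReal _ hK0, abs_le]
    have h1 := hPlip s hs t ht
    have h2 := hPlip t ht s hs
    rw [abs_sub_comm t s] at h2
    constructor <;> linarith
  have hP0 : P 0 ≤ c := hPle 0 c le_rfl h0
  have key : ∀ t ∈ Ioo 0 T, P t ≤ c := by
    intro t₁ ht₁
    have hmaps : ∀ s ∈ Icc 0 t₁, t₁ - s ∈ Icc 0 T := fun s hs =>
      ⟨sub_nonneg.2 hs.2, by linarith [hs.1, ht₁.2]⟩
    -- Following f at a maximum point x₀ bounds `P` from below at other times, with equality at the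
    -- chosen time. This controls backward difference quotients of `P`, so time is reversed to
    -- obtain right slopes.
    have hslope : ∀ s ∈ Ico 0 t₁, ∀ r, 0 < r →
        ∃ᶠ z in 𝓝[>] s, slope (fun s => -P (t₁ - s)) s z < r := by
      intro s hs r hr
      apply Eventually.frequently
      have hτ : t₁ - s ∈ Ioo 0 T := ⟨sub_pos.2 hs.2, by linarith [hs.1, ht₁.2]⟩
      have hnear : ∀ᶠ z in 𝓝[>] s, z ∈ Ioo s t₁ := Ioo_mem_nhdsGT hs.2
      rcases eq_or_lt_of_le (le_max_left c (⨆ x, f (t₁ - s) x)) with h | h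
      · filter_upwards [hnear] with z hz
        rw [slope_def_field]
        refine lt_of_le_of_lt (div_nonpos_of_nonpos_of_nonneg ?_ (sub_nonneg.2 hz.1.le)) hr
        have h1 : c ≤ P (t₁ - z) := le_max_left _ _
        have h2 : P (t₁ - s) = c := h.symm
        rw [h2]
        linarith
      · have hreg := hf.regular _ (Ioo_subset_Icc_self hτ)
        have hsup : c < ⨆ x, f (t₁ - s) x := (lt_max_iff.1 h).resolve_left (lt_irrefl c)
        obtain ⟨z₀, hz₀⟩ := exists_lt_of_lt_ciSup hsup
        obtain ⟨x₀, hx₀⟩ := hreg.exists_forall_le (hc.trans_lt hz₀)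
        have hPx : P (t₁ - s) ≤ f (t₁ - s) x₀ := hPle _ _ (hz₀.le.trans (hx₀ z₀)) hx₀
        obtain ⟨p, hp, hd⟩ := hf.equation _ hτ x₀
        have hp0 := hp.nonpos_of_forall_le hf.width_pos hf.bound_lt hreg hx₀
        have hg : HasDerivAt (fun z => -f (t₁ - z) x₀) (C * p) s := by
          have := (hd.comp_const_sub t₁ s).neg
          rwa [neg_neg] at this
        have hlt : C * p < r :=
          (mul_nonpos_of_nonneg_of_nonpos hf.const_pos.le hp0).trans_lt hr
        have hev := ((hasDerivAt_iff_tendsto_slope.1 hg).mono_left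
          (nhdsWithin_mono s fun z (hz : s < z) => hz.ne')).eventually (Iio_mem_nhds hlt)
        filter_upwards [hnear, hev] with z hz hzlt
        refine lt_of_le_of_lt ?_ hzlt
        rw [slope_def_field, slope_def_field]
        have h1 := hfP (t₁ - z) (hmaps z ⟨hs.1.trans hz.1.le, hz.2.le⟩) x₀
        have h2 : 0 ≤ z - s := sub_nonneg.2 hz.1.le
        gcongr
    have hcont : ContinuousOn (fun s => -P (t₁ - s)) (Icc 0 t₁) :=
      (hPcont.comp (by fun_prop) hmaps).neg
    refine le_of_forall_pos_le_add fun ε hε => ?_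
    have hεt : 0 < ε / t₁ := div_pos hε ht₁.1
    -- The comparison needs a strict inequality of slopes, 0 < ε/t₁; over the length t₁ this costs
    -- only ε.
    have := image_le_of_liminf_slope_right_lt_deriv_boundary (f' := fun _ => 0) hcont hslope
      (B := fun s => -P t₁ + ε / t₁ * s) (B' := fun _ => ε / t₁) (by simp)
      (fun s => by simpa using ((hasDerivAt_id s).const_mul (ε / t₁)).const_add (-P t₁))
      (fun s _ _ => hεt) (right_mem_Icc.2 ht₁.1.le)
    simp only [sub_self] at this
    rw [div_mul_cancel₀ _ ht₁.1.ne'] at this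
    linarith
  rcases eq_or_lt_of_le ht.1 with rfl | h1
  · exact h0 x
  rcases eq_or_lt_of_le ht.2 with rfl | h2
  -- The equation holds only at interior times; the final time follows by continuity.
  · have hcl := (hf.continuous_time x).mono Ioc_subset_Icc_self t (right_mem_Ioc.2 h1)
    have hne : (𝓝[Ioo 0 t] t).NeBot := right_nhdsWithin_Ioo_neBot h1
    refine le_of_tendsto (hcl.mono Ioo_subset_Ioc_self) ?_
    filter_upwards [self_mem_nhdsWithin] with s hs
    exact (hfP s (Ioo_subset_Icc_self hs) x).trans (key s hs)
  · exact (hfP t ht x).trans (key t ⟨h1, h2⟩)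

end RegularSolution

/-! ### Conservation of mass -/

namespace RegularSolution

variable {C l m L T : ℝ} {f : ℝ → ℝ → ℝ}

theorem hasDerivAt_integral_mul (hf : RegularSolution C l m L T f) {ψ : ℝ → ℝ}
    (hψ : ContDiff ℝ 1 ψ) (hc : HasCompactSupport ψ) {t : ℝ} (ht : t ∈ Ioo 0 T) :
    HasDerivAt (fun s => ∫ x, f s x * ψ x)
      (-(C * (2 / waveNumber l)) * ∫ x, deriv ψ x * flux l (f t) x) t := by
  obtain ⟨K, hK0, hK⟩ := hf.exists_abs_deriv_le
  have hcont : ∀ s ∈ Ioo 0 T, Continuous (f s) := fun s hs =>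
    (hf.regular s (Ioo_subset_Icc_self hs)).differentiable.continuous
  have hreg := hf.regular t (Ioo_subset_Icc_self ht)
  have hψi : Integrable ψ := hψ.continuous.integrable_of_hasCompactSupport hc
  have hmeas : AEStronglyMeasurable fun x =>
      (C * ∫ η, reducedIntegrand l (f t) x η) * ψ x := by
    refine AEStronglyMeasurable.mul ?_ hψ.continuous.aestronglyMeasurable
    exact ((measurable_reducedIntegrand hreg).stronglyMeasurable.integral_prod_right
      (ν := volume)).aestronglyMeasurable.const_mul C
  have := (hasDerivAt_integral_of_dominated_loc_of_deriv_le (μ := volume) (s := Ioo 0 T)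
    (F := fun s x => f s x * ψ x)
    (F' := fun s x => (C * ∫ η, reducedIntegrand l (f s) x η) * ψ x)
    (bound := fun x => K * |ψ x|) (isOpen_Ioo.mem_nhds ht)
    (by
      filter_upwards [isOpen_Ioo.mem_nhds ht] with s hs
      exact ((hcont s hs).mul hψ.continuous).aestronglyMeasurable)
    (((hcont t ht).mul hψ.continuous).integrable_of_hasCompactSupport hc.mul_left)
    hmeas
    (ae_of_all _ fun x s hs => by
      rw [norm_mul, Real.norm_eq_abs, Real.norm_eq_abs]
      exact mul_le_mul_of_nonneg_right (hK s hs x) (abs_nonneg _))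
    (hψi.abs.const_mul K)
    (ae_of_all _ fun x s hs => (hf.hasDerivAt hs x).mul_const (ψ x))).2
  convert! this using 1
  have e : ∀ x, (C * ∫ η, reducedIntegrand l (f t) x η) * ψ x =
      C * (ψ x * ∫ η, reducedIntegrand l (f t) x η) := fun x => by ring
  simp_rw [e]
  rw [integral_const_mul, integral_mul_reducedIntegrand_eq hf.width_pos hf.bound_lt hreg hψ hc]
  ring

/-- By the mean value theorem in time, only the flux where ψ' ≠ 0 matters. -/
theorem abs_integral_mul_sub_le (hf : RegularSolution C l m L T f) {ψ : ℝ → ℝ}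
    (hψ : ContDiff ℝ 1 ψ) (hc : HasCompactSupport ψ) {δ : ℝ}
    (hδ : ∀ t ∈ Icc 0 T, ∀ x, deriv ψ x ≠ 0 → |flux l (f t) x| ≤ δ) {t : ℝ} (ht : t ∈ Icc 0 T) :
    |(∫ x, f t x * ψ x) - ∫ x, f 0 x * ψ x| ≤
      C * (2 / waveNumber l) * (δ * ∫ x, |deriv ψ x|) * t := by
  rcases eq_or_lt_of_le ht.1 with rfl | ht0
  · simp
  have h0T : (0 : ℝ) ∈ Icc 0 T := ⟨le_rfl, ht.1.trans ht.2⟩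
  have hμ := waveNumber_pos hf.width_pos
  obtain ⟨K, hK0, hK⟩ := hf.exists_lipschitz
  have hψi : Integrable ψ := hψ.continuous.integrable_of_hasCompactSupport hc
  have hi : ∀ s ∈ Icc 0 T, Integrable fun x => f s x * ψ x := fun s hs =>
    ((hf.regular s hs).differentiable.continuous.mul hψ.continuous).integrable_of_hasCompactSupport
      hc.mul_left
  have hcont : ContinuousOn (fun s => ∫ x, f s x * ψ x) (Icc 0 T) := by
    refine (LipschitzOnWith.of_dist_le_mul (K := (K * ∫ x, |ψ x|).toNNReal)
      fun s hs r hr => ?_).continuousOn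
    rw [Real.dist_eq, Real.dist_eq, Real.coe_toNNReal _
      (mul_nonneg hK0 (integral_nonneg fun x => abs_nonneg _)), ← integral_sub (hi s hs) (hi r hr)]
    have : K * (∫ x, |ψ x|) * |s - r| = ∫ x, K * |s - r| * |ψ x| := by
      rw [integral_const_mul]; ring
    rw [this, ← Real.norm_eq_abs]
    refine norm_integral_le_of_norm_le (hψi.abs.const_mul _) (ae_of_all _ fun x => ?_)
    rw [← sub_mul, norm_mul, Real.norm_eq_abs, Real.norm_eq_abs]
    exact mul_le_mul_of_nonneg_right (hK s hs r hr x) (abs_nonneg _)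
  obtain ⟨r, hr, hr'⟩ := exists_hasDerivAt_eq_slope (fun s => ∫ x, f s x * ψ x) _ ht0
    (hcont.mono (Icc_subset_Icc_right ht.2))
    (fun r hr => hf.hasDerivAt_integral_mul hψ hc ⟨hr.1, hr.2.trans_le ht.2⟩)
  have hψ'i : Integrable fun x => |deriv ψ x| :=
    ((hψ.continuous_deriv le_rfl).integrable_of_hasCompactSupport hc.deriv).abs
  have hflux : |∫ x, deriv ψ x * flux l (f r) x| ≤ δ * ∫ x, |deriv ψ x| := by
    rw [← integral_const_mul, ← Real.norm_eq_abs]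
    refine norm_integral_le_of_norm_le (hψ'i.const_mul δ) (ae_of_all _ fun x => ?_)
    rw [norm_mul, Real.norm_eq_abs, Real.norm_eq_abs, mul_comm]
    by_cases h : deriv ψ x = 0
    · simp [h]
    · exact mul_le_mul_of_nonneg_right (hδ r ⟨hr.1.le, hr.2.le.trans ht.2⟩ x h) (abs_nonneg _)
  rw [sub_zero, eq_div_iff ht0.ne'] at hr'
  rw [← hr', abs_mul, abs_mul, abs_neg, abs_of_pos ht0,
    abs_of_pos (mul_pos hf.const_pos (div_pos two_pos hμ))]
  have := hf.const_pos
  gcongr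

/-- Conservation of mass, tested against wide cutoffs. -/
theorem eventually_abs_integral_cutoff_sub_le (hf : RegularSolution C l m L T f) (hT : 0 ≤ T)
    {ε : ℝ} (hε : 0 < ε) : ∀ᶠ R in atTop, ∀ t ∈ Icc 0 T,
      |(∫ x, f t x * cutoff (x / R)) - ∫ x, f 0 x * cutoff (x / R)| ≤ ε := by
  have hμ := waveNumber_pos hf.width_pos
  have hC := hf.const_pos
  set I := ∫ x, |deriv cutoff x|
  have hI : 0 ≤ I := integral_nonneg fun x => abs_nonneg _
  -- The tolerance for the flux is ε/(B + 1), since B may vanish.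
  set B := C * (2 / waveNumber l) * I * T with hB
  have hB0 : 0 ≤ B := by positivity
  have hδ : 0 < ε / (B + 1) := by positivity
  have hev := (tendsto_flux_zero hf.width_pos hf.bound_lt hf.regular hf.tendsto_zero).eventually
    (Metric.ball_mem_nhds 0 hδ)
  obtain ⟨pa, hpa, pb, hpb, hab⟩ := eventually_prod_iff.1 hev
  obtain ⟨S, hS, hSsub⟩ := mem_cocompact.1 hpb
  obtain ⟨r, hr⟩ := hS.isBounded.subset_closedBall 0
  filter_upwards [eventually_gt_atTop r, eventually_gt_atTop 0] with R hR hR0 t ht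
  have h := hf.abs_integral_mul_sub_le (contDiff_cutoff_div R) (hasCompactSupport_cutoff_div hR0)
    (δ := ε / (B + 1)) (fun s hs x hx => by
      have hx' : R ≤ |x| := by
        by_contra h
        exact hx (deriv_cutoff_div_eq_zero hR0 (not_le.1 h))
      have hxS : pb x := hSsub fun hxS => by
        have := hr hxS
        rw [mem_closedBall_zero_iff, Real.norm_eq_abs] at this
        linarith
      have := hab (eventually_principal.1 hpa s hs) hxS
      rw [Real.dist_eq, sub_zero] at this
      exact this.le) ht
  refine h.trans ?_
  rw [integral_abs_deriv_cutoff_div hR0]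
  calc _ ≤ C * (2 / waveNumber l) * (ε / (B + 1) * I) * T := by
        gcongr
        exact ht.2
    _ = ε * (B / (B + 1)) := by rw [hB]; ring
    _ ≤ ε * 1 := by
        gcongr
        rw [div_le_one (by positivity)]
        linarith
    _ = ε := mul_one ε

theorem nonneg_of_initial_nonneg (hf : RegularSolution C l m L T f) (h0 : ∀ x, 0 ≤ f 0 x) {t : ℝ} (ht : t ∈ Icc 0 T) (x : ℝ) : 0 ≤ f t x := by
  have := hf.neg.le_of_initial_le le_rfl (fun x => by simpa using h0 x) ht x
  simpa using this

theorem integrable_and_integral_le (hf : RegularSolution C l m L T f)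
    (h0 : ∀ x, 0 ≤ f 0 x) (hint : Integrable (f 0)) {t : ℝ} (ht : t ∈ Icc 0 T) :
    Integrable (f t) ∧ ∫ x, f t x ≤ ∫ x, f 0 x := by
  apply integrable_and_integral_le_of_cutoff (hf.regular t ht).differentiable.continuous
    (hf.nonneg_of_initial_nonneg h0 ht)
  intro ε hε
  filter_upwards [hf.eventually_abs_integral_cutoff_sub_le (ht.1.trans ht.2) hε] with R hR
  have h1 := (abs_le.1 (hR t ht)).2
  have h2 : ∫ x, f 0 x * cutoff (x / R) ≤ ∫ x, f 0 x := by
    refine integral_mono_of_nonneg (ae_of_all _ fun x => mul_nonneg (h0 x) cutoff.nonneg) hint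
      (ae_of_all _ fun x => mul_le_of_le_one_right (h0 x) cutoff.le_one)
  linarith

/-- Mass conservation read backwards: if a later slice vanishes, the initial masses against wide
cutoffs are arbitrarily small. -/
theorem eq_zero_of_slice_eq_zero (hf : RegularSolution C l m L T f)
    (h0 : ∀ x, 0 ≤ f 0 x) (hint : Integrable (f 0)) {t : ℝ} (ht : t ∈ Icc 0 T) (hz : f t = 0) : f 0 = 0 := by
  have h0T : (0 : ℝ) ∈ Icc 0 T := ⟨le_rfl, ht.1.trans ht.2⟩
  have hc := (hf.regular 0 h0T).differentiable.continuous
  have h := (integrable_and_integral_le_of_cutoff hc h0 (A := 0) fun ε hε => by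
    filter_upwards [hf.eventually_abs_integral_cutoff_sub_le (ht.1.trans ht.2) hε] with R hR
    have h1 := (abs_le.1 (hR t ht)).1
    have h2 : ∫ x, f t x * cutoff (x / R) = 0 := by simp [hz]
    linarith).2
  have h2 : ∫ x, f 0 x = 0 := le_antisymm h (integral_nonneg h0)
  have h3 := (integral_eq_zero_iff_of_nonneg h0 hint).1 h2
  exact (hc.ae_eq_iff_eq (μ := volume) continuous_zero).1 h3

end RegularSolution

/-! ### The decay estimate and steady states -/

/-- The rate in the decay estimate, as a function of the mass `a`, the maximum `M`, the densities
and the half-width of the strip. -/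
noncomputable def decayRate (a M ρ2 ρ1 l : ℝ) : ℝ :=
  (ρ2 - ρ1) / (8 * l) * (Real.cos (waveNumber l * M) ^ 3 * waveNumber l * a / 10)

theorem decayRate_pos {a M ρ2 ρ1 l : ℝ} (ha : 0 < a) (hM : 0 < M) (hMl : M < l) (hρ : ρ1 < ρ2) :
    0 < decayRate a M ρ2 ρ1 l := by
  have hl := hM.trans hMl
  have h1 := waveNumber_pos hl
  have h2 := cos_waveNumber_mul_pos hl hM.le hMl
  have h3 := sub_pos.2 hρ
  unfold decayRate
  positivity

theorem lpNorm_one_eq_integral_of_nonneg {u : ℝ → ℝ} (hi : Integrable u) (h : ∀ x, 0 ≤ u x) :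
    lpNorm u 1 volume = ∫ x, u x := by
  rw [lpNorm_one_eq_integral_norm hi.aestronglyMeasurable]
  simp_rw [Real.norm_of_nonneg (h _)]

theorem integral_pos_of_nonneg_of_ne_zero {u : ℝ → ℝ} (hc : Continuous u) (hi : Integrable u)
    (h : ∀ x, 0 ≤ u x) (hne : u ≠ 0) : 0 < ∫ x, u x := by
  refine lt_of_le_of_ne (integral_nonneg h) fun h0 => hne ?_
  exact (hc.ae_eq_iff_eq (μ := volume) continuous_zero).1 ((integral_eq_zero_iff_of_nonneg h hi).1 h0.symm)

theorem RegularProfile.exists_max_of_nonneg_of_ne_zero {m L : ℝ} {u : ℝ → ℝ}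
    (hu : RegularProfile m L u) (h : ∀ x, 0 ≤ u x) (hne : u ≠ 0) :
    ∃ x, (∀ y, u y ≤ u x) ∧ 0 < u x ∧ lpNorm u ∞ volume = u x := by
  obtain ⟨z, hz⟩ := Function.ne_iff.1 hne
  have hz' : 0 < u z := lt_of_le_of_ne (h z) (Ne.symm hz)
  obtain ⟨x, hx⟩ := hu.exists_forall_le hz'
  have hpos := hz'.trans_le (hx z)
  have hc := hu.differentiable.continuous
  have hle : ∀ y, |u y| ≤ u x := fun y => by rw [abs_of_nonneg (h y)]; exact hx y
  refine ⟨x, hx, hpos, le_antisymm (hc.lpNorm_top_le hpos.le hle) ?_⟩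
  have hb : eLpNorm u ∞ volume < ⊤ := by
    rw [eLpNorm_exponent_top]
    exact (eLpNormEssSup_le_of_ae_bound (ae_of_all _ hle)).trans_lt ENNReal.ofReal_lt_top
  exact (le_abs_self _).trans (hc.abs_le_lpNorm_top hb x)

theorem IsSteadyState.neg {ρ1 ρ2 l : ℝ} {u : ℝ → ℝ} (hs : IsSteadyState ρ1 ρ2 l u) :
    IsSteadyState ρ1 ρ2 l (-u) := fun x => by simpa using (hs x).neg

theorem IsSteadyState.eq_zero {ρ1 ρ2 l m L : ℝ} {u : ℝ → ℝ} (hs : IsSteadyState ρ1 ρ2 l u)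
    (hρ : ρ1 < ρ2) (hl : 0 < l) (hm : m < l) (hu : RegularProfile m L u) (hi : Integrable u)
    (h : ∀ x, 0 ≤ u x) : u = 0 := by
  by_contra hne
  obtain ⟨x, hmax, hpos, -⟩ := hu.exists_max_of_nonneg_of_ne_zero h hne
  obtain ⟨p, hp, hp0⟩ := hs x
  have hA := integral_pos_of_nonneg_of_ne_zero hu.differentiable.continuous hi h hne
  have hle := hp.le_of_forall_le hl hm hu hmax hpos h hi hA le_rfl hm
    ((le_abs_self _).trans (hu.bound x))
  have hk0 := cos_waveNumber_mul_pos hl hu.bound_nonneg hm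
  have hμ := waveNumber_pos hl
  -- The steady equation makes a positive multiple of p equal to zero, contradicting this strict
  -- sign.
  have hp1 : p < 0 := hle.trans_lt (neg_neg_of_pos (by positivity))
  have hC : 0 < (ρ2 - ρ1) / (8 * l) := div_pos (sub_pos.2 hρ) (by positivity)
  have := mul_neg_of_pos_of_neg hC hp1
  linarith

theorem mainTheorem2 :
    (∃ c : ℝ → ℝ → ℝ → ℝ → ℝ → ℝ,
      (∀ a m ρ2 ρ1 l : ℝ, 0 < a → 0 < m → m < l → ρ1 < ρ2 → 0 < c a m ρ2 ρ1 l) ∧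
      ∀ (ρ1 ρ2 l : ℝ) (k : ℕ) (T : ℝ) (f₀ : ℝ → ℝ) (f : ℝ → ℝ → ℝ),
        ρ1 < ρ2 → 0 < l → 3 ≤ k → 0 < T →
        (∀ x, 0 ≤ f₀ x) → f₀ ≠ 0 → Integrable f₀ volume → MemHkl k l f₀ →
        IsClassicalSolution ρ1 ρ2 l k T f₀ f →
        (∀ t ∈ Icc 0 T, 0 < lpNorm (f t) ∞ volume) ∧
        (∃ K : ℝ≥0, LipschitzOnWith K (fun t => lpNorm (f t) ∞ volume) (Icc 0 T)) ∧
        (∀ᵐ t ∂(volume.restrict (Ioo 0 T)),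
          DifferentiableAt ℝ (fun t => lpNorm (f t) ∞ volume) t) ∧
        (∀ t ∈ Ioo 0 T, ∀ M' : ℝ, HasDerivAt (fun t => lpNorm (f t) ∞ volume) M' t →
          M' ≤ -c (lpNorm f₀ 1 volume) (lpNorm f₀ ∞ volume) ρ2 ρ1 l *
            Real.exp (-(Real.pi * lpNorm f₀ 1 volume) / (l * lpNorm (f t) ∞ volume)))) ∧
    (∀ (ρ1 ρ2 l : ℝ) (k : ℕ) (u : ℝ → ℝ),
      ρ1 < ρ2 → 0 < l → 3 ≤ k → Integrable u volume → MemHkl k l u →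
      ((∀ x, 0 ≤ u x) ∨ (∀ x, u x ≤ 0)) → IsSteadyState ρ1 ρ2 l u → u = 0) := by
  refine ⟨⟨decayRate, fun a m ρ2 ρ1 l ha hm hml hρ => decayRate_pos ha hm hml hρ, ?_⟩, ?_⟩
  · intro ρ1 ρ2 l k T f₀ f hρ hl hk hT hnn hne hint hmem hsol
    obtain ⟨m, L, hf⟩ := hsol.exists_regularSolution hρ hl hk
    have hinit := hsol.initial
    have h0T : (0 : ℝ) ∈ Icc 0 T := ⟨le_rfl, hT.le⟩
    rw [← hinit] at hnn hne hint hmem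
    rw [← hinit]
    have hnnt : ∀ t ∈ Icc 0 T, ∀ x, 0 ≤ f t x := fun t ht => hf.nonneg_of_initial_nonneg hnn ht
    have hnet : ∀ t ∈ Icc 0 T, f t ≠ 0 := fun t ht h =>
      hne (hf.eq_zero_of_slice_eq_zero hnn hint ht h)
    have hmax : ∀ t ∈ Icc 0 T, ∃ x, (∀ y, f t y ≤ f t x) ∧ 0 < f t x ∧
        lpNorm (f t) ∞ volume = f t x := fun t ht =>
      (hf.regular t ht).exists_max_of_nonneg_of_ne_zero (hnnt t ht) (hnet t ht)
    have hle : ∀ t ∈ Icc 0 T, ∀ x, f t x ≤ lpNorm (f t) ∞ volume := fun t ht x =>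
      (le_abs_self _).trans ((hsol.mem t ht).abs_le_lpNorm x)
    obtain ⟨K, hK0, hK⟩ := hf.exists_lipschitz
    have hstep : ∀ s ∈ Icc 0 T, ∀ t ∈ Icc 0 T,
        lpNorm (f s) ∞ volume ≤ lpNorm (f t) ∞ volume + K * |s - t| := by
      intro s hs t ht
      obtain ⟨x, -, -, hx⟩ := hmax s hs
      have h1 := (abs_le.1 (hK s hs t ht x)).2
      have h2 := hle t ht x
      linarith
    have hlip : LipschitzOnWith K.toNNReal (fun t => lpNorm (f t) ∞ volume) (Icc 0 T) := by
      refine LipschitzOnWith.of_dist_le_mul fun s hs t ht => ?_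
      rw [Real.dist_eq, Real.dist_eq, Real.coe_toNNReal _ hK0, abs_le]
      have h1 := hstep s hs t ht
      have h2 := hstep t ht s hs
      rw [abs_sub_comm t s] at h2
      constructor <;> linarith
    refine ⟨fun t ht => ?_, ⟨_, hlip⟩, ?_, fun t ht M' hM' => ?_⟩
    · obtain ⟨x, -, hpos, hx⟩ := hmax t ht
      rwa [hx]
    · rw [ae_restrict_iff' measurableSet_Ioo]
      filter_upwards [hlip.ae_differentiableWithinAt_of_mem_real] with t h ht
      exact (h (Ioo_subset_Icc_self ht)).differentiableAt (Icc_mem_nhds ht.1 ht.2)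
    · have htI := Ioo_subset_Icc_self ht
      obtain ⟨x, hxmax, hxpos, hx⟩ := hmax t htI
      obtain ⟨p, hp, hd⟩ := hf.equation t ht x
      -- The norm dominates f(s, x) for all s, with equality at s = t, so the two functions of time
      -- have the same derivative there.
      have hmin : IsLocalMin (fun s => lpNorm (f s) ∞ volume - f s x) t := by
        filter_upwards [Icc_mem_nhds ht.1 ht.2] with s hs
        rw [hx, sub_self, sub_nonneg]
        exact hle s hs x
      have hM'eq : M' = _ := sub_eq_zero.1 (hmin.hasDerivAt_eq_zero (hM'.sub hd))
      have hA : 0 < lpNorm (f 0) 1 volume := by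
        rw [lpNorm_one_eq_integral_of_nonneg hint hnn]
        exact integral_pos_of_nonneg_of_ne_zero hmem.continuous hint hnn hne
      obtain ⟨hti, htle⟩ := hf.integrable_and_integral_le hnn hint htI
      rw [← lpNorm_one_eq_integral_of_nonneg hint hnn] at htle
      -- The maximum principle allows m₀ = ‖f₀‖_∞, just as the mass bound allows A = ‖f₀‖_{L¹}.
      have hxle : f t x ≤ lpNorm (f 0) ∞ volume :=
        hf.le_of_initial_le lpNorm_nonneg (hle 0 h0T) htI x
      have := hp.le_of_forall_le hl hf.bound_lt (hf.regular t htI) hxmax hxpos (hnnt t htI) hti hA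
        htle (hmem.lpNorm_lt hl) hxle
      rw [hM'eq, hx, decayRate]
      refine (mul_le_mul_of_nonneg_left this hf.const_pos.le).trans_eq ?_
      ring
  · intro ρ1 ρ2 l k u hρ hl hk hi hu hsign hs
    obtain ⟨L, hreg⟩ := hu.exists_regularProfile hk
    have hlt := hu.lpNorm_lt hl
    rcases hsign with h | h
    · exact hs.eq_zero hρ hl hlt hreg hi h
    · exact neg_eq_zero.1 (hs.neg.eq_zero hρ hl hlt hreg.neg hi.neg fun x => neg_nonneg.2 (h x))
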